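/- Let $(E,\mathcal M,\mathbf m)$ be a separable probability space, write $L^p(\mathbf m)$ for real $L^p$-spaces, $\|\cdot\|_p$ for their norms, $\langle\cdot,\cdot\rangle$ for the inner product of $L^2(\mathbf m)$ and $\mathbf m(f)=\int f\,d\mathbf m$. Let $(L,\mathcal D(L))$ be a negative definite self-adjoint operator on $L^2(\mathbf m)$ with discrete spectrum: there is an orthonormal basis $\{e_i\}_{i\ge1}$ (finite if $L^2(\mathbf m)$ is finite-dimensional) with $e_i\in\mathcal D(L)$, $Le_i=-\lambda_ie_i$, where $0<\lambda_1\le\lambda_2\le\cdots$ (and $\lambda_i\to\infty$ if the basis is infinite). For $\alpha>0$ put $(-L)^\alpha x=\sum_i\lambda_i^\alpha\langle x,e_i\rangle e_i$ on the domain $\{x:\sum_i\lambda_i^{2\alpha}\langle x,e_i\rangle^2<\infty\}$. Let $H$ be the completion of $L^2(\mathbf m)$ under $\langle x,y\rangle_H=\sum_i\lambda_i^{-1}\langle x,e_i\rangle\langle y,e_i\rangle$. A closed densely defined operator $A$ on $L^2(\mathbf m)$ is called a Dirichlet operator if $\langle Au,(u-1)^+\rangle\le0$ for all $u\in\mathcal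 D(A)$. Let $r\in(0,1)$, $\varepsilon\in(0,1)$, $d\in\bigl(0,\frac{2\varepsilon(1+r)}{1-r}\bigr)$, and suppose that: (i) (Nash inequality) there is $C>0$ with $\|f\|_2^{2+4/d}\le C\langle f,-Lf\rangle$ for all $f\in\mathcal D(L)$ with $\mathbf m(|f|)=1$; (ii) $-(-L)^{1/n}$ is a Dirichlet operator for some integer $n\ge1$; (iii) $(q_i)_{i\ge1}$ are real numbers with $\sum_i q_i^2/\lambda_i<\infty$, and there are $c>0$ and $\sigma\ge\frac4{1+r}$ such that $q_i\ge c\,\lambda_i^{\frac{\sigma+2\varepsilon-2}{2\sigma}}$ for all $i$. Then there is exactly one bounded linear operator $Q:L^2(\mathbf m)\to H$ with $Qe_i=q_ie_i$ for all $i$, and $Q$ is Hilbert–Schmidt. Moreover the embedding $L^{r+1}(\mathbf m)\subset H$ exists and is compact; that is, there is an injective compact linear map $L^{r+1}(\mathbf m)\to H$ which on $L^2(\mathbf m)$ is the inclusion $L^2(\mathbf m)\subset H$. Finally, for the same $\sigma$ there is a constant $\xi>0$ such that, regarding $x\in L^{r+1}(\mathbf m)$ as an element of $H$, $$\|x\|_{r+1}^2\,\|x\|_H^{\sigma-2}\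 \ge\ \xi\,\|x\|_Q^\sigma\qquad\text{for all }x\in L^{r+1}(\mathbf m),$$ where $\|x\|_Q=\|y\|_2$ if $x=Qy$ with $y\in L^2(\mathbf m)$, and $\|x\|_Q=\infty$ if there is no such $y$. -/

import Mathlib

open MeasureTheory Filter Topology
open scoped ENNReal InnerProductSpace

noncomputable section

namespace FastDiffusion

variable {E : Type*} [MeasurableSpace E] {m : Measure E}

/-- The real Hilbert space `L²(m)`. -/
abbrev L2 (m : Measure E) : Type _ := Lp ℝ 2 m

/-- The eigenvalues and eigenfunctions of a negative definite operator `L` on `L²(m)` with discrete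
spectrum: `basis` is an orthonormal basis of eigenfunctions, `L (basis i) = - ev i • basis i`, all
`ev i` are positive, and only finitely many of them (with multiplicity) lie below any given bound.
The index type is `ℕ` when `L²(m)` is infinite-dimensional and the eigenvalues are listed in
increasing order, and it is finite when `L²(m)` is finite-dimensional; the order of the list plays
no role. -/
structure EigenSystem (L : L2 m →ₗ.[ℝ] L2 m) (ι : Type*) where
  /-- the eigenfunctions `e_i` -/
  basis : HilbertBasis ι ℝ (L2 m)
  /-- the eigenvalues `λ_i` of `-L` -/
  ev : ι → ℝ
  ev_pos : ∀ i, 0 < ev i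
  finite_le : ∀ R : ℝ, {i | ev i ≤ R}.Finite
  mem_domain : ∀ i, basis i ∈ L.domain
  apply_basis : ∀ i, L ⟨basis i, mem_domain i⟩ = -(ev i • basis i)

namespace EigenSystem

variable {L : L2 m →ₗ.[ℝ] L2 m} {ι : Type*} (S : EigenSystem L ι)

/-! ### The space `H` -/

theorem exists_inv_ev_le : ∃ K : ℝ, ∀ i, (S.ev i)⁻¹ ≤ K := by
  obtain ⟨K, hK⟩ := ((S.finite_le 1).image fun i => (S.ev i)⁻¹).bddAbove
  refine ⟨max K 1, fun i => ?_⟩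
  rcases le_or_gt (S.ev i) 1 with h | h
  · exact (hK ⟨i, h, rfl⟩).trans (le_max_left _ _)
  · exact (inv_le_one_of_one_le₀ h.le).trans (le_max_right _ _)

/-- `⟨x, y⟩_H = ∑ i, λ_i⁻¹ ⟨x, e_i⟩ ⟨y, e_i⟩`. -/
def innerH (x y : L2 m) : ℝ :=
  ∑' i, (S.ev i)⁻¹ * (⟪x, S.basis i⟫_ℝ * ⟪y, S.basis i⟫_ℝ)

theorem summable_innerH (x y : L2 m) :
    Summable fun i => (S.ev i)⁻¹ * (⟪x, S.basis i⟫_ℝ * ⟪y, S.basis i⟫_ℝ) := by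
  obtain ⟨K, hK⟩ := S.exists_inv_ev_le
  have h : Summable fun i => ⟪x, S.basis i⟫_ℝ * ⟪y, S.basis i⟫_ℝ := by
    simpa only [real_inner_comm] using S.basis.summable_inner_mul_inner x y
  refine Summable.of_norm_bounded (h.abs.mul_left K) fun i => ?_
  rw [Real.norm_eq_abs, abs_mul, abs_of_pos (inv_pos.2 (S.ev_pos i))]
  exact mul_le_mul_of_nonneg_right (hK i) (abs_nonneg _)

/-- `L²(m)`, to be equipped with the inner product of `H`. -/
def PreH (_S : EigenSystem L ι) : Type _ := L2 m

instance : AddCommGroup S.PreH := inferInstanceAs (AddCommGroup (L2 m))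
instance : Module ℝ S.PreH := inferInstanceAs (Module ℝ (L2 m))

/-- The identity map from `L²(m)` to `L²(m)` with the inner product of `H`. -/
def toPreH : L2 m ≃ₗ[ℝ] S.PreH := LinearEquiv.refl ℝ (L2 m)

instance preHCore : InnerProductSpace.Core ℝ S.PreH where
  inner x y := S.innerH (S.toPreH.symm x) (S.toPreH.symm y)
  conj_inner_symm x y := by
    simp only [innerH, conj_trivial]
    exact tsum_congr fun i => by ring
  re_inner_nonneg x := by
    simp only [innerH, RCLike.re_to_real]
    exact tsum_nonneg fun i => mul_nonneg (inv_pos.2 (S.ev_pos i)).le (mul_self_nonneg _)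
  add_left x y z := by
    simp only [innerH, map_add, inner_add_left]
    rw [← (S.summable_innerH _ _).tsum_add (S.summable_innerH _ _)]
    exact tsum_congr fun i => by ring
  smul_left x y a := by
    simp only [innerH, map_smul, real_inner_smul_left, conj_trivial]
    rw [← tsum_mul_left]
    exact tsum_congr fun i => by ring
  definite x h := by
    have hs := (S.summable_innerH (S.toPreH.symm x) (S.toPreH.symm x)).hasSum
    have hz : ∑' i, (S.ev i)⁻¹ *
        (⟪S.toPreH.symm x, S.basis i⟫_ℝ * ⟪S.toPreH.symm x, S.basis i⟫_ℝ) = 0 := h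
    rw [hz] at hs
    have h0 := (hasSum_zero_iff_of_nonneg fun i =>
      mul_nonneg (inv_pos.2 (S.ev_pos i)).le (mul_self_nonneg _)).1 hs
    have h1 : S.toPreH.symm x = 0 := by
      apply S.basis.repr.injective
      ext i
      have := congrFun h0 i
      simp only [Pi.zero_apply, mul_eq_zero, inv_eq_zero, (S.ev_pos i).ne', false_or, or_self]
        at this
      rw [S.basis.repr_apply_apply, real_inner_comm, this]
      simp
    simpa using h1

instance : NormedAddCommGroup S.PreH := InnerProductSpace.Core.toNormedAddCommGroup (𝕜 := ℝ)
instance : InnerProductSpace ℝ S.PreH := InnerProductSpace.ofCore S.preHCore.toCore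

/-- The Hilbert space `H`: the completion of `L²(m)` under `⟨·, ·⟩_H`. -/
abbrev H : Type _ := UniformSpace.Completion S.PreH

/-- The inclusion `L²(m) ⊂ H`. -/
def toH : L2 m →ₗ[ℝ] S.H :=
  (UniformSpace.Completion.toComplₗᵢ (𝕜 := ℝ) (E := S.PreH)).toLinearMap ∘ₗ S.toPreH.toLinearMap

theorem inner_toH (x y : L2 m) : ⟪S.toH x, S.toH y⟫_ℝ = S.innerH x y :=
  UniformSpace.Completion.inner_coe (𝕜 := ℝ) (S.toPreH x) (S.toPreH y)

/-! ### Fractional powers -/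

/-- The fractional power `(-L)^α`, as an unbounded operator: its domain is the set of `x` with
`∑ i, λ_i^(2α) ⟨x, e_i⟩² < ∞`, and `(-L)^α x = ∑ i, λ_i^α ⟨x, e_i⟩ e_i`. -/
def negPow (α : ℝ) : L2 m →ₗ.[ℝ] L2 m where
  domain :=
    { carrier := {x | Memℓp (fun i => S.ev i ^ α * ⟪S.basis i, x⟫_ℝ) 2}
      add_mem' := fun {x y} hx hy => by
        have h : (fun i => S.ev i ^ α * ⟪S.basis i, x + y⟫_ℝ) =
            (fun i => S.ev i ^ α * ⟪S.basis i, x⟫_ℝ) +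
              fun i => S.ev i ^ α * ⟪S.basis i, y⟫_ℝ := by
          ext i; simp [inner_add_right, mul_add]
        change Memℓp _ 2
        rw [h]
        exact Memℓp.add hx hy
      zero_mem' := by
        have h : (fun i => S.ev i ^ α * ⟪S.basis i, (0 : L2 m)⟫_ℝ) = 0 := by
          ext i; simp
        change Memℓp _ 2
        rw [h]
        exact zero_memℓp
      smul_mem' := fun a x hx => by
        have h : (fun i => S.ev i ^ α * ⟪S.basis i, a • x⟫_ℝ) =
            a • fun i => S.ev i ^ α * ⟪S.basis i, x⟫_ℝ := by
          ext i; simp [inner_smul_right, mul_left_comm]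
        change Memℓp _ 2
        rw [h]
        exact Memℓp.const_smul hx a }
  toFun :=
    { toFun := fun x => S.basis.repr.symm ⟨fun i => S.ev i ^ α * ⟪S.basis i, (x : L2 m)⟫_ℝ, x.2⟩
      map_add' := fun x y => by
        rw [← map_add]
        congr 1
        ext i
        exact (congrArg _ (inner_add_right _ _ _)).trans (mul_add _ _ _)
      map_smul' := fun a x => by
        rw [RingHom.id_apply, ← map_smul]
        congr 1
        ext i
        simp [inner_smul_right, mul_left_comm] }

/-! ### Operators with values in `H` and the embedding of `L^p(m)` -/

/-- `Q : L²(m) → H` is the bounded operator with `Q e_i = q_i e_i`. -/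
def IsDiagonal (q : ι → ℝ) (Q : L2 m →L[ℝ] S.H) : Prop :=
  ∀ i, Q (S.basis i) = q i • S.toH (S.basis i)

/-- `Q` is a Hilbert-Schmidt operator from `L²(m)` to `H`. -/
def IsHilbertSchmidt (Q : L2 m →L[ℝ] S.H) : Prop :=
  Summable fun i => ‖Q (S.basis i)‖ ^ 2

/-- `‖x‖_Q = ‖y‖₂` if `x = Q y` with `y ∈ L²(m)`, and `‖x‖_Q = ∞` if there is no such `y`.
(For injective `Q` the infimum is over at most one `y`.) -/
def qNorm (Q : L2 m →L[ℝ] S.H) (x : S.H) : ℝ≥0∞ :=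
  ⨅ (y : L2 m) (_ : Q y = x), ‖y‖ₑ

/-- `J` is the embedding `L^p(m) ⊂ H`: a continuous injective linear map that agrees with the
inclusion `L²(m) ⊂ H` on the functions that belong to both `L²(m)` and `L^p(m)`. -/
def IsEmbedding {p : ℝ≥0∞} [Fact (1 ≤ p)] (J : Lp ℝ p m →L[ℝ] S.H) : Prop :=
  Function.Injective J ∧ ∀ (f : L2 m) (g : Lp ℝ p m), f =ᵐ[m] g → J g = S.toH f

end EigenSystem

/-- `A` is a Dirichlet operator on `L²(m)`: closed, densely defined, and
`⟨A u, (u - 1)⁺⟩ ≤ 0` for all `u ∈ D(A)`. -/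
def IsDirichletOperator (A : L2 m →ₗ.[ℝ] L2 m) : Prop :=
  Dense (A.domain : Set (L2 m)) ∧ A.IsClosed ∧
    ∀ u : A.domain, ∫ x, (A u : L2 m) x * max ((u : L2 m) x - 1) 0 ∂m ≤ 0

/-- The Nash inequality of dimension `d` for `L`: for some constant `C > 0`,
`‖f‖₂^(2 + 4/d) ≤ C ⟨f, -L f⟩` for all `f ∈ D(L)` with `m(|f|) = 1`. -/
def NashInequality (L : L2 m →ₗ.[ℝ] L2 m) (d : ℝ) : Prop :=
  ∃ C : ℝ, 0 < C ∧ ∀ f : L.domain, ∫ x, |(f : L2 m) x| ∂m = 1 →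
    ‖(f : L2 m)‖ ^ (2 + 4 / d) ≤ C * ⟪(f : L2 m), -(L f)⟫_ℝ

theorem fact_one_le_ofReal {r : ℝ} (hr : 0 < r) : Fact (1 ≤ ENNReal.ofReal (r + 1)) :=
  ⟨by simpa using hr.le⟩

end FastDiffusion

end

/-! The embedding is built as `D ∘ V`: `V` extends `(-L)^(-ε/2)` continuously from `L²(m)` to a map
`L^(1+r)(m) → L²(m)`, and `D` is the diagonal operator `L²(m) → H` which restores the missing power
`λ_i^((ε-1)/2)`. Since `ε < 1` and `λ_i → ∞`, `D` is compact and injective, so two facts about `V`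
remain: boundedness and injectivity.

Boundedness (`exists_sobolev`) rests on the Nash inequality together with contractivity on `L¹(m)`.
The Dirichlet property concerns only `(-L)^(1/n)`, so the resolvents of that operator are the ones
known to contract `L¹(m)`; their `n`-th power gains one full order of `-L`, which is what the Nash
inequality for `L` needs. Iterating over doubling parameters (`exists_iterated_smoothing`) bounds
`exp(-t (-L)^(1/n))` from `L¹(m)` to `L²(m)` by a multiple of `t^(-nd/4)`. Cutting a function at a
suitable height gives the corresponding bound from `L^(1+r)(m)`, and a dyadic sum over `t = 2^(-j)`
gives `(-L)^(-ε/2)`. The sum converges exactly because `d < 2ε(1+r)/(1-r)`.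

Injectivity of a continuous extension is not automatic; `injective_of_extends_invPow` obtains it
from the same `L¹` contractions.

The final inequality is Hölder's inequality on coefficients (`exists_preimage_norm_le`): the lower
bound on `q_i` dominates the coefficients of `Q⁻¹ D y` by a geometric mean of those of `D y` and
`y`, and `‖V x‖₂` is controlled by `‖x‖_{r+1}`. -/

noncomputable section

/-! ### Diagonal operators with respect to Hilbert bases -/

namespace HilbertBasis

variable {ι E F : Type*} [NormedAddCommGroup E] [InnerProductSpace ℝ E]
  [NormedAddCommGroup F] [InnerProductSpace ℝ F]

theorem hasSum_sq_repr (b : HilbertBasis ι ℝ E) (x : E) :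
    HasSum (fun i => b.repr x i ^ 2) (‖x‖ ^ 2) := by
  have h := b.hasSum_inner_mul_inner x x
  rw [real_inner_self_eq_norm_sq] at h
  have h2 : (fun i => b.repr x i ^ 2) = fun i => ⟪x, b i⟫_ℝ * ⟪b i, x⟫_ℝ := by
    funext i
    rw [b.repr_apply_apply, real_inner_comm x, sq]
  rwa [h2]

theorem exists_repr_eq (b : HilbertBasis ι ℝ E) {a : ι → ℝ} (ha : Summable fun i => a i ^ 2) :
    ∃ x : E, ∀ i, b.repr x i = a i := by
  have hm : Memℓp a 2 := by
    rw [memℓp_gen_iff (by norm_num)]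
    simpa using ha
  exact ⟨b.repr.symm ⟨a, hm⟩, fun i => by simp⟩

theorem ext_repr (b : HilbertBasis ι ℝ E) {x y : E} (h : ∀ i, b.repr x i = b.repr y i) : x = y :=
  b.repr.injective (lp.ext (funext h))

theorem norm_le_mul_norm_of_repr (b : HilbertBasis ι ℝ E) (b' : HilbertBasis ι ℝ F) {K : ℝ}
    (hK : 0 ≤ K) {x : E} {y : F} (h : ∀ i, |b.repr x i| ≤ K * |b'.repr y i|) :
    ‖x‖ ≤ K * ‖y‖ := by
  refine abs_le_of_sq_le_sq' ?_ (by positivity) |>.2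
  rw [mul_pow]
  refine hasSum_le (fun i => ?_) (b.hasSum_sq_repr x) ((b'.hasSum_sq_repr y).mul_left (K ^ 2))
  rw [← sq_abs, ← sq_abs (b'.repr y i), ← mul_pow]
  exact pow_le_pow_left₀ (abs_nonneg _) (h i) 2

theorem exists_repr_eq_mul (b : HilbertBasis ι ℝ E) (b' : HilbertBasis ι ℝ F) {a : ι → ℝ} {K : ℝ}
    (ha : ∀ i, |a i| ≤ K) (x : E) : ∃ y : F, ∀ i, b'.repr y i = a i * b.repr x i := by
  refine b'.exists_repr_eq (Summable.of_nonneg_of_le (fun i => sq_nonneg _) (fun i => ?_)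
    ((b.hasSum_sq_repr x).summable.mul_left (K ^ 2)))
  rw [mul_pow]
  exact mul_le_mul_of_nonneg_right (sq_le_sq' (abs_le.1 (ha i)).1 (abs_le.1 (ha i)).2) (sq_nonneg _)

/-- The bounded operator that multiplies the coefficients with respect to `b` by a bounded
sequence, and takes the result as coefficients with respect to `b'`. -/
def diagonal (b : HilbertBasis ι ℝ E) (b' : HilbertBasis ι ℝ F) (a : ι → ℝ)
    (ha : ∃ K, ∀ i, |a i| ≤ K) : E →L[ℝ] F :=
  have hy := fun x => b.exists_repr_eq_mul b' ha.choose_spec x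
  LinearMap.mkContinuousOfExistsBound
    { toFun := fun x => (hy x).choose
      map_add' := fun x y => b'.ext_repr fun i => by
        have h1 := (hy (x + y)).choose_spec i
        have h2 := (hy x).choose_spec i
        have h3 := (hy y).choose_spec i
        simp only [map_add, lp.coeFn_add, Pi.add_apply] at *
        rw [h1, h2, h3]; ring
      map_smul' := fun c x => b'.ext_repr fun i => by
        have h1 := (hy (c • x)).choose_spec i
        have h2 := (hy x).choose_spec i
        simp only [map_smul, lp.coeFn_smul, Pi.smul_apply, smul_eq_mul, RingHom.id_apply] at *
        rw [h1, h2]; ring }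
    ⟨max ha.choose 0, fun x => b'.norm_le_mul_norm_of_repr b (le_max_right _ _) fun i => by
      have h := (hy x).choose_spec i
      simp only [LinearMap.coe_mk, AddHom.coe_mk]
      rw [h, abs_mul]
      exact mul_le_mul_of_nonneg_right ((ha.choose_spec i).trans (le_max_left _ _)) (abs_nonneg _)⟩

variable (b : HilbertBasis ι ℝ E) (b' : HilbertBasis ι ℝ F)

@[simp]
theorem repr_diagonal {a : ι → ℝ} (ha : ∃ K, ∀ i, |a i| ≤ K) (x : E) (i : ι) :
    b'.repr (b.diagonal b' a ha x) i = a i * b.repr x i :=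
  (b.exists_repr_eq_mul b' ha.choose_spec x).choose_spec i

theorem norm_diagonal_apply_le {a : ι → ℝ} (ha : ∃ K, ∀ i, |a i| ≤ K) {K : ℝ} (hK : 0 ≤ K)
    (h : ∀ i, |a i| ≤ K) (x : E) : ‖b.diagonal b' a ha x‖ ≤ K * ‖x‖ :=
  b'.norm_le_mul_norm_of_repr b hK fun i => by
    rw [repr_diagonal, abs_mul]
    exact mul_le_mul_of_nonneg_right (h i) (abs_nonneg _)

theorem diagonal_apply_basis {a : ι → ℝ} (ha : ∃ K, ∀ i, |a i| ≤ K) (i : ι) :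
    b.diagonal b' a ha (b i) = a i • b' i := by
  classical
  refine b'.ext_repr fun j => ?_
  simp only [repr_diagonal, map_smul, lp.coeFn_smul, Pi.smul_apply, smul_eq_mul,
    HilbertBasis.repr_self]
  by_cases h : j = i
  · subst h; simp
  · simp [lp.single_apply, h]

theorem inner_diagonal_left {a : ι → ℝ} (ha : ∃ K, ∀ i, |a i| ≤ K) (x y : E) :
    ⟪b.diagonal b a ha x, y⟫_ℝ = ⟪x, b.diagonal b a ha y⟫_ℝ := by
  rw [← b.tsum_inner_mul_inner, ← b.tsum_inner_mul_inner]
  refine tsum_congr fun i => ?_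
  have h1 := b.repr_diagonal b ha x i
  have h2 := b.repr_diagonal b ha y i
  rw [HilbertBasis.repr_apply_apply, HilbertBasis.repr_apply_apply] at h1 h2
  rw [real_inner_comm, h1, h2, real_inner_comm x]; ring

/-- Truncating the sequence to a finite set gives finite-rank operators, and these converge in
operator norm because the remaining tail is uniformly small. -/
theorem isCompactOperator_diagonal [CompleteSpace F] {a : ι → ℝ} (ha : ∃ K, ∀ i, |a i| ≤ K)
    (h0 : Tendsto a cofinite (𝓝 0)) : IsCompactOperator (b.diagonal b' a ha) := by
  classical
  have hbd : ∀ s : Finset ι, ∃ K, ∀ i, |if i ∈ s then a i else 0| ≤ K := fun s => by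
    obtain ⟨K, hK⟩ := ha
    refine ⟨K, fun i => ?_⟩
    split_ifs
    · exact hK i
    · simpa using (abs_nonneg _).trans (hK i)
  refine isCompactOperator_of_tendsto (l := (atTop : Filter (Finset ι)))
    (F := fun s => b.diagonal b' (fun i => if i ∈ s then a i else 0) (hbd s)) ?_
    (Eventually.of_forall fun s => ?_)
  · rw [tendsto_iff_norm_sub_tendsto_zero, Metric.tendsto_atTop]
    intro δ hδ
    have hfin : {i | ¬ |a i| < δ / 2}.Finite := by
      have := (h0.abs.eventually (gt_mem_nhds (by simpa using half_pos hδ : |(0:ℝ)| < δ / 2)))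
      exact this
    refine ⟨hfin.toFinset, fun s hs => ?_⟩
    rw [dist_zero_right, norm_norm]
    refine lt_of_le_of_lt (ContinuousLinearMap.opNorm_le_bound _ (half_pos hδ).le fun x => ?_)
      (half_lt_self hδ)
    refine b'.norm_le_mul_norm_of_repr b (half_pos hδ).le fun i => ?_
    simp only [sub_apply, map_sub, lp.coeFn_sub, Pi.sub_apply, repr_diagonal]
    rw [← sub_mul, abs_mul]
    refine mul_le_mul_of_nonneg_right ?_ (abs_nonneg _)
    split_ifs with hi
    · simpa using (half_pos hδ).le
    · by_contra hcon
      refine hi (hs ?_)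
      rw [Set.Finite.mem_toFinset]
      intro hlt
      apply hcon
      simpa using hlt.le
  · have hsum : b.diagonal b' (fun i => if i ∈ s then a i else 0) (hbd s) =
        ∑ i ∈ s, a i • (innerSL ℝ (b i)).smulRight (b' i) := by
      ext x
      refine b'.ext_repr fun j => ?_
      simp only [repr_diagonal, sum_apply, map_sum,
        smul_apply, ContinuousLinearMap.smulRight_apply, innerSL_apply_apply, map_smul,
        lp.coeFn_sum, Finset.sum_apply, lp.coeFn_smul, Pi.smul_apply, smul_eq_mul,
        HilbertBasis.repr_self, lp.single_apply, Pi.single_apply, ← HilbertBasis.repr_apply_apply]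
      simp
    rw [hsum]
    refine Finset.sum_induction _ (fun T : E →L[ℝ] F => IsCompactOperator T)
      (fun S T hS hT => hS.add hT) isCompactOperator_zero fun i _ => ?_
    refine IsCompactOperator.smul (f := (innerSL ℝ (b i)).smulRight (b' i)) ?_ (a i)
    exact (isCompactOperator_of_locallyCompactSpace_rng
      (ContinuousLinearMap.toSpanSingleton ℝ (b' i))).comp_clm
      (innerSL ℝ (b i))

end HilbertBasis

/-- Hölder's inequality with the conjugate exponents `1/(1-θ)` and `1/θ`. -/
theorem tsum_rpow_mul_rpow_le {ι : Type*} {u v : ι → ℝ} (hu : ∀ i, 0 ≤ u i) (hv : ∀ i, 0 ≤ v i)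
    (hus : Summable u) (hvs : Summable v) {θ : ℝ} (h0 : 0 < θ) (h1 : θ < 1) :
    Summable (fun i => u i ^ (1 - θ) * v i ^ θ) ∧
    ∑' i, u i ^ (1 - θ) * v i ^ θ ≤ (∑' i, u i) ^ (1 - θ) * (∑' i, v i) ^ θ := by
  have hpq : (1 - θ)⁻¹.HolderConjugate θ⁻¹ :=
    Real.HolderConjugate.inv_inv (by linarith) h0 (by ring)
  have hue : ∀ i, (u i ^ (1 - θ)) ^ (1 - θ)⁻¹ = u i := fun i =>
    Real.rpow_rpow_inv (hu i) (by linarith)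
  have hve : ∀ i, (v i ^ θ) ^ θ⁻¹ = v i := fun i => Real.rpow_rpow_inv (hv i) h0.ne'
  have := Real.summable_and_inner_le_Lp_mul_Lq_tsum_of_nonneg hpq
    (f := fun i => u i ^ (1 - θ)) (g := fun i => v i ^ θ)
    (fun i => Real.rpow_nonneg (hu i) _) (fun i => Real.rpow_nonneg (hv i) _)
    (by simpa only [hue] using hus) (by simpa only [hve] using hvs)
  simpa only [hue, hve, one_div, inv_inv] using this

/-! ### Inclusions of `L^p` spaces; `L` and the Nash inequality in coefficients -/

namespace FastDiffusion

variable {E : Type*} [MeasurableSpace E] {m : Measure E}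

/-- The inclusion of `L^q(m)` in `L^p(m)` for `p ≤ q` and a probability measure `m`. -/
def inclLp [IsProbabilityMeasure m] {p q : ℝ≥0∞} (h : p ≤ q) : Lp ℝ q m →ₗ[ℝ] Lp ℝ p m where
  toFun f := ⟨f.1, Lp.antitone h f.2⟩
  map_add' _ _ := rfl
  map_smul' _ _ := rfl

section Inclusion

variable [IsProbabilityMeasure m] {p q s : ℝ≥0∞}

theorem coeFn_inclLp (h : p ≤ q) (f : Lp ℝ q m) : (inclLp h f : E → ℝ) = f := rfl

theorem inclLp_inclLp (h : p ≤ q) (h' : q ≤ s) (f : Lp ℝ s m) :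
    inclLp h (inclLp h' f) = inclLp (h.trans h') f := rfl

theorem norm_inclLp_le (h : p ≤ q) (f : Lp ℝ q m) : ‖inclLp h f‖ ≤ ‖f‖ := by
  rw [Lp.norm_def, Lp.norm_def, coeFn_inclLp]
  exact ENNReal.toReal_mono (Lp.eLpNorm_ne_top f)
    (eLpNorm_le_eLpNorm_of_exponent_le h (Lp.aestronglyMeasurable f))

theorem inclLp_injective (h : p ≤ q) : Function.Injective (inclLp (m := m) h) := fun _ _ hfg =>
  Subtype.ext (congrArg (fun u : Lp ℝ p m => (u : E →ₘ[m] ℝ)) hfg)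

theorem denseRange_inclLp [Fact (1 ≤ p)] (hp : p ≠ ∞) (h : p ≤ q) :
    DenseRange (inclLp (m := m) h) := by
  refine (Lp.simpleFunc.dense (E := ℝ) (μ := m) hp).mono fun f hf => ?_
  obtain ⟨g, hg⟩ := hf
  have hq : MemLp g q m := (g.memLp_of_isFiniteMeasure q m)
  refine ⟨hq.toLp g, Subtype.ext ?_⟩
  rw [← hg]
  rfl

theorem norm_inclLp_one (h : 1 ≤ q) (f : Lp ℝ q m) : ‖inclLp h f‖ = ∫ x, |f x| ∂m := by
  rw [L1.norm_eq_integral_norm]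
  rfl

end Inclusion

namespace EigenSystem

variable {L : L2 m →ₗ.[ℝ] L2 m} {ι : Type*} (S : EigenSystem L ι)

theorem exists_le_ev : ∃ δ : ℝ, 0 < δ ∧ ∀ i, δ ≤ S.ev i := by
  obtain ⟨K, hK⟩ := S.exists_inv_ev_le
  refine ⟨(max K 1)⁻¹, by positivity, fun i => ?_⟩
  exact inv_le_of_inv_le₀ (S.ev_pos i) ((hK i).trans (le_max_left _ _))

theorem tendsto_ev : Tendsto S.ev cofinite atTop := by
  rw [tendsto_atTop]
  intro R
  refine (S.finite_le R).subset fun i hi => ?_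
  exact (not_le.1 (show ¬ R ≤ S.ev i from hi)).le

theorem exists_ev_rpow_le {α : ℝ} (hα : α ≤ 0) : ∃ K : ℝ, 0 < K ∧ ∀ i, S.ev i ^ α ≤ K := by
  obtain ⟨δ, hδ, h⟩ := S.exists_le_ev
  exact ⟨δ ^ α, by positivity, fun i => Real.rpow_le_rpow_of_nonpos hδ (h i) hα⟩

theorem exists_abs_ev_rpow_le {α : ℝ} (hα : α ≤ 0) : ∃ K : ℝ, ∀ i, |S.ev i ^ α| ≤ K := by
  obtain ⟨K, -, hK⟩ := S.exists_ev_rpow_le hα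
  exact ⟨K, fun i => by rw [abs_of_pos (Real.rpow_pos_of_pos (S.ev_pos i) _)]; exact hK i⟩

/-- The operator `(-L)^(-α)`. -/
def invPow {α : ℝ} (hα : 0 ≤ α) : L2 m →L[ℝ] L2 m :=
  S.basis.diagonal S.basis (fun i => S.ev i ^ (-α)) (S.exists_abs_ev_rpow_le (by linarith))

theorem repr_invPow {α : ℝ} (hα : 0 ≤ α) (f : L2 m) (i : ι) :
    S.basis.repr (S.invPow hα f) i = S.ev i ^ (-α) * S.basis.repr f i :=
  HilbertBasis.repr_diagonal _ _ _ _ _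

theorem repr_apply (hL : IsSelfAdjoint L) (x : L.domain) (i : ι) :
    S.basis.repr (L x) i = -(S.ev i * S.basis.repr (x : L2 m) i) := by
  have h := LinearPMap.adjoint_isFormalAdjoint hL.dense_domain
  rw [LinearPMap.isSelfAdjoint_def.1 hL] at h
  have := h ⟨S.basis i, S.mem_domain i⟩ x
  rw [S.apply_basis, inner_neg_left, real_inner_smul_left] at this
  rw [S.basis.repr_apply_apply, S.basis.repr_apply_apply]
  exact this.symm

/-- Self-adjointness, rather than mere symmetry, is essential here: the summability produces a
vector representing `L* x`, and `L*` has the same domain as `L`. -/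
theorem mem_domain_of_summable (hL : IsSelfAdjoint L) {x : L2 m}
    (hx : Summable fun i => (S.ev i * S.basis.repr x i) ^ 2) : x ∈ L.domain := by
  obtain ⟨w, hw⟩ := S.basis.exists_repr_eq hx
  rw [← LinearPMap.isSelfAdjoint_def.1 hL]
  refine LinearPMap.mem_adjoint_domain_of_exists _ ⟨-w, fun y => ?_⟩
  rw [← S.basis.tsum_inner_mul_inner, ← S.basis.tsum_inner_mul_inner]
  refine tsum_congr fun i => ?_
  have h1 := S.repr_apply hL y i
  have h2 := hw i
  rw [S.basis.repr_apply_apply] at h1 h2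
  rw [S.basis.repr_apply_apply] at h1 h2
  rw [inner_neg_left, real_inner_comm, h2, h1, real_inner_comm (S.basis i) x]
  ring

theorem hasSum_energy (hL : IsSelfAdjoint L) (x : L.domain) :
    HasSum (fun i => S.ev i * S.basis.repr (x : L2 m) i ^ 2) ⟪(x : L2 m), -(L x)⟫_ℝ := by
  have h := S.basis.hasSum_inner_mul_inner (x : L2 m) (-(L x))
  have h2 : (fun i => S.ev i * S.basis.repr (x : L2 m) i ^ 2) =
      fun i => ⟪(x : L2 m), S.basis i⟫_ℝ * ⟪S.basis i, -(L x)⟫_ℝ := by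
    funext i
    rw [← S.basis.repr_apply_apply, map_neg, lp.coeFn_neg, Pi.neg_apply, S.repr_apply hL,
      real_inner_comm, ← S.basis.repr_apply_apply]
    ring
  rwa [h2]

/-- The Nash inequality in terms of coefficients, for all functions in the unit ball of `L¹(m)`. -/
theorem exists_nash [IsProbabilityMeasure m] (hL : IsSelfAdjoint L) {d : ℝ} (hd : 0 < d)
    (hN : NashInequality L d) :
    ∃ C : ℝ, 0 < C ∧ ∀ x : L2 m, (Summable fun i => (S.ev i * S.basis.repr x i) ^ 2) →
      ‖inclLp (p := 1) one_le_two x‖ ≤ 1 →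
      ‖x‖ ^ (2 + 4 / d) ≤ C * ∑' i, S.ev i * S.basis.repr x i ^ 2 := by
  obtain ⟨C, hC, h⟩ := hN
  refine ⟨C, hC, fun x hx hx1 => ?_⟩
  have hnn : 0 ≤ ∑' i, S.ev i * S.basis.repr x i ^ 2 :=
    tsum_nonneg fun i => mul_nonneg (S.ev_pos i).le (sq_nonneg _)
  rcases eq_or_ne x 0 with rfl | hx0
  · rw [norm_zero, Real.zero_rpow (by positivity)]
    positivity
  set a := ‖inclLp (p := 1) one_le_two x‖ with ha
  have hane : inclLp (p := 1) one_le_two x ≠ 0 := fun h0 =>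
    hx0 (inclLp_injective one_le_two (h0.trans (map_zero _).symm))
  have ha0 : 0 < a := norm_pos_iff.2 hane
  let X : L.domain := ⟨x, S.mem_domain_of_summable hL hx⟩
  have hE := (S.hasSum_energy hL X).tsum_eq
  have h1 := h (a⁻¹ • X) (by
    rw [← norm_inclLp_one one_le_two, Submodule.coe_smul, map_smul, norm_smul, ← ha,
      Real.norm_of_nonneg (by positivity), inv_mul_cancel₀ ha0.ne'])
  rw [LinearPMap.map_smul, Submodule.coe_smul, ← smul_neg, real_inner_smul_left,
    real_inner_smul_right, ← hE, norm_smul, Real.norm_of_nonneg (by positivity),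
    Real.mul_rpow (by positivity) (norm_nonneg _)] at h1
  have hX : (X : L2 m) = x := rfl
  rw [hX, Real.inv_rpow ha0.le, inv_mul_le_iff₀ (by positivity)] at h1
  refine h1.trans ?_
  -- Rescaling to `m(|f|) = 1` leaves a factor `a^(4/d)`, since the two sides have degrees `2 + 4/d`
  -- and `2`; it is harmless because `a ≤ 1`.
  have h2 : a ^ (2 + 4 / d) = a ^ 2 * a ^ (4 / d) := by
    rw [Real.rpow_add ha0, Real.rpow_two]
  have h3 : a ^ (4 / d) ≤ 1 := Real.rpow_le_one ha0.le hx1 (by positivity)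
  calc _ = a ^ (4 / d) * (C * ∑' i, S.ev i * S.basis.repr x i ^ 2) := by
        rw [h2]; field_simp
    _ ≤ _ := mul_le_of_le_one_left (by positivity) h3

end EigenSystem
end FastDiffusion

/-! ### Resolvents of `(-L)^α` and their Markov property -/

namespace FastDiffusion

/-- Scalar form of the resolvent identity `A R = s⁻¹ (1 - R)` for `R = (1 + s A)⁻¹`. -/
theorem mul_inv_one_add_mul {s t : ℝ} (hs : s ≠ 0) (h : 1 + s * t ≠ 0) (y : ℝ) :
    t * ((1 + s * t)⁻¹ * y) = s⁻¹ * (y - (1 + s * t)⁻¹ * y) := by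
  obtain ⟨z, rfl⟩ : ∃ z, y = (1 + s * t) * z := ⟨(1 + s * t)⁻¹ * y, by rw [mul_inv_cancel_left₀ h]⟩
  rw [inv_mul_cancel_left₀ h, eq_inv_mul_iff_mul_eq₀ hs]
  ring

namespace EigenSystem

variable {E : Type*} [MeasurableSpace E] {m : Measure E}
variable {L : L2 m →ₗ.[ℝ] L2 m} {ι : Type*} (S : EigenSystem L ι)

theorem one_le_one_add_mul (α : ℝ) {s : ℝ} (hs : 0 < s) (i : ι) : 1 ≤ 1 + s * S.ev i ^ α :=
  le_add_of_nonneg_right (mul_nonneg hs.le (Real.rpow_nonneg (S.ev_pos i).le α))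

theorem abs_inv_one_add_mul_le (α : ℝ) {s : ℝ} (hs : 0 < s) (i : ι) :
    |(1 + s * S.ev i ^ α)⁻¹| ≤ 1 := by
  have h := S.one_le_one_add_mul α hs i
  rw [abs_of_nonneg (by positivity)]
  exact inv_le_one_of_one_le₀ h

/-- The resolvent `(1 + s (-L)^α)⁻¹`. -/
def resolvent (α : ℝ) {s : ℝ} (hs : 0 < s) : L2 m →L[ℝ] L2 m :=
  S.basis.diagonal S.basis (fun i => (1 + s * S.ev i ^ α)⁻¹)
    ⟨1, S.abs_inv_one_add_mul_le α hs⟩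

theorem repr_resolvent (α : ℝ) {s : ℝ} (hs : 0 < s) (f : L2 m) (i : ι) :
    S.basis.repr (S.resolvent α hs f) i = (1 + s * S.ev i ^ α)⁻¹ * S.basis.repr f i :=
  HilbertBasis.repr_diagonal _ _ _ _ _

theorem repr_resolvent_pow (α : ℝ) {s : ℝ} (hs : 0 < s) (k : ℕ) (f : L2 m) (i : ι) :
    S.basis.repr ((S.resolvent α hs ^ k) f) i =
      ((1 + s * S.ev i ^ α) ^ k)⁻¹ * S.basis.repr f i := by
  induction k with
  | zero => simp
  | succ k ih =>
    rw [pow_succ', mul_apply_eq_comp, repr_resolvent, ih, pow_succ, mul_inv]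
    ring

theorem repr_negPow (α : ℝ) (x : (S.negPow α).domain) (i : ι) :
    S.basis.repr (S.negPow α x) i = S.ev i ^ α * S.basis.repr (x : L2 m) i := by
  rw [S.basis.repr_apply_apply (x : L2 m)]
  change S.basis.repr (S.basis.repr.symm _) i = _
  rw [LinearIsometryEquiv.apply_symm_apply]

theorem resolvent_mem_domain (α : ℝ) {s : ℝ} (hs : 0 < s) (f : L2 m) :
    S.resolvent α hs f ∈ (S.negPow α).domain := by
  change Memℓp _ 2
  have h : ∀ i, S.ev i ^ α * ⟪S.basis i, S.resolvent α hs f⟫_ℝ =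
      S.basis.repr (s⁻¹ • (f - S.resolvent α hs f)) i := fun i => by
    rw [← S.basis.repr_apply_apply, map_smul, map_sub, lp.coeFn_smul, lp.coeFn_sub, Pi.smul_apply,
      Pi.sub_apply, repr_resolvent, smul_eq_mul]
    exact mul_inv_one_add_mul hs.ne' (zero_lt_one.trans_le (S.one_le_one_add_mul α hs i)).ne' _
  rw [funext h]
  exact lp.memℓp _

theorem negPow_resolvent (α : ℝ) {s : ℝ} (hs : 0 < s) (f : L2 m) :
    S.negPow α ⟨S.resolvent α hs f, S.resolvent_mem_domain α hs f⟩ =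
      s⁻¹ • (f - S.resolvent α hs f) := by
  refine S.basis.ext_repr fun i => ?_
  rw [repr_negPow, map_smul, map_sub, lp.coeFn_smul, lp.coeFn_sub, Pi.smul_apply,
      Pi.sub_apply, repr_resolvent, smul_eq_mul]
  exact mul_inv_one_add_mul hs.ne' (zero_lt_one.trans_le (S.one_le_one_add_mul α hs i)).ne' _

section Markov

variable [IsProbabilityMeasure m] {α : ℝ}

/-- Testing the Dirichlet property on `v = R f` gives `∫ (v - f) (v - 1)⁺ ≤ 0`. As `f ≤ 1`, the
integrand is nonnegative, and it is positive wherever `v > 1`; so that set is null. -/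
theorem resolvent_le_one (hA : IsDirichletOperator (-(S.negPow α))) {s : ℝ} (hs : 0 < s) {f : L2 m} (hf : ∀ᵐ x ∂m, f x ≤ 1) :
    ∀ᵐ x ∂m, S.resolvent α hs f x ≤ 1 := by
  set v := S.resolvent α hs f with hv
  have h := hA.2.2 ⟨v, S.resolvent_mem_domain α hs f⟩
  have hval : (-(S.negPow α)) ⟨v, S.resolvent_mem_domain α hs f⟩ = s⁻¹ • (v - f) := by
    rw [LinearPMap.neg_apply]
    refine (congrArg Neg.neg (S.negPow_resolvent α hs f)).trans ?_
    rw [← smul_neg, neg_sub]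
  rw [hval] at h
  have hae : (fun x => (s⁻¹ • (v - f) : L2 m) x * max (v x - 1) 0) =ᵐ[m]
      fun x => s⁻¹ * ((v x - f x) * max (v x - 1) 0) := by
    filter_upwards [Lp.coeFn_smul s⁻¹ (v - f), Lp.coeFn_sub v f] with x h1 h2
    rw [h1, Pi.smul_apply, h2, Pi.sub_apply, smul_eq_mul, mul_assoc]
  rw [integral_congr_ae hae, integral_const_mul] at h
  have h' : ∫ x, (v x - f x) * max (v x - 1) 0 ∂m ≤ 0 :=
    nonpos_of_mul_nonpos_right h (inv_pos.2 hs)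
  have hpos : 0 ≤ᵐ[m] fun x => (v x - f x) * max (v x - 1) 0 := by
    filter_upwards [hf] with x hx
    rcases le_total (v x) 1 with h1 | h1
    · simp [max_eq_right (sub_nonpos.2 h1)]
    · exact mul_nonneg (by linarith) (le_max_right _ _)
  have hint : Integrable (fun x => (v x - f x) * max (v x - 1) 0) m :=
    ((Lp.memLp v).sub (Lp.memLp f)).integrable_mul
      (((Lp.memLp v).sub (memLp_const (1 : ℝ))).pos_part)
  have h0 := (integral_eq_zero_iff_of_nonneg_ae hpos hint).1
    (le_antisymm h' (integral_nonneg_of_ae hpos))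
  filter_upwards [hf, h0] with x hx hx0
  by_contra hlt
  rw [not_le] at hlt
  have : 0 < (v x - f x) * max (v x - 1) 0 :=
    mul_pos (by linarith) (lt_max_of_lt_left (by linarith))
  exact this.ne' hx0

theorem abs_resolvent_le_one (hA : IsDirichletOperator (-(S.negPow α))) {s : ℝ} (hs : 0 < s) {f : L2 m} (hf : ∀ᵐ x ∂m, |f x| ≤ 1) :
    ∀ᵐ x ∂m, |S.resolvent α hs f x| ≤ 1 := by
  have h1 := S.resolvent_le_one hA hs (f := f) (hf.mono fun x hx => (abs_le.1 hx).2)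
  have h2 := S.resolvent_le_one hA hs (f := -f) (by
    filter_upwards [hf, Lp.coeFn_neg f] with x hx hn
    rw [hn, Pi.neg_apply]
    linarith [(abs_le.1 hx).1])
  rw [map_neg] at h2
  filter_upwards [h1, h2, Lp.coeFn_neg (S.resolvent α hs f)] with x h1 h2 hn
  rw [hn, Pi.neg_apply] at h2
  exact abs_le.2 ⟨by linarith, h1⟩

/-- The resolvent is a contraction for the norm of `L¹(m)`, by duality. -/
theorem norm_inclLp_resolvent_le (hA : IsDirichletOperator (-(S.negPow α))) {s : ℝ} (hs : 0 < s) (f : L2 m) :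
    ‖inclLp (p := 1) one_le_two (S.resolvent α hs f)‖ ≤ ‖inclLp (p := 1) one_le_two f‖ := by
  set v := S.resolvent α hs f with hv
  -- The sign of `v` is the bounded function that attains the `L¹` norm by duality; the symmetric
  -- resolvent is then moved onto it.
  have hmeas : AEStronglyMeasurable (fun x => if 0 ≤ v x then (1 : ℝ) else -1) m := by
    have : Measurable (fun y : ℝ => if 0 ≤ y then (1 : ℝ) else -1) :=
      Measurable.ite measurableSet_Ici measurable_const measurable_const
    exact (this.comp_aemeasurable (Lp.aestronglyMeasurable v).aemeasurable).aestronglyMeasurable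
  have hle : ∀ y : ℝ, |if 0 ≤ y then (1 : ℝ) else -1| ≤ 1 := fun y => by split_ifs <;> simp
  have hmem : MemLp (fun x => if 0 ≤ v x then (1 : ℝ) else -1) 2 m :=
    MemLp.of_bound hmeas 1 (ae_of_all _ fun x => hle _)
  set g := hmem.toLp _ with hg
  have hgx := hmem.coeFn_toLp
  have hg1 : ∀ᵐ x ∂m, |g x| ≤ 1 := hgx.mono fun x hx => by rw [hg, hx]; exact hle _
  rw [norm_inclLp_one, norm_inclLp_one]
  calc ∫ x, |v x| ∂m = ⟪v, g⟫_ℝ := by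
        rw [MeasureTheory.L2.inner_def]
        refine integral_congr_ae (hgx.mono fun x hx => ?_)
        simp only [RCLike.inner_apply, conj_trivial]
        rw [hg, hx]
        beta_reduce
        split_ifs with h0
        · rw [abs_of_nonneg h0, one_mul]
        · rw [abs_of_neg (not_le.1 h0), neg_one_mul]
    _ = ⟪f, S.resolvent α hs g⟫_ℝ := HilbertBasis.inner_diagonal_left _ _ _ _
    _ = ∫ x, S.resolvent α hs g x * f x ∂m := by
        rw [MeasureTheory.L2.inner_def]
        rfl
    _ ≤ ∫ x, |f x| ∂m := by
        refine integral_mono_ae ((Lp.memLp _).integrable_mul (Lp.memLp _))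
          ((Lp.memLp f).integrable one_le_two).abs ?_
        filter_upwards [S.abs_resolvent_le_one hA hs hg1] with x hx
        refine (le_abs_self _).trans ?_
        rw [abs_mul]
        exact mul_le_of_le_one_left (abs_nonneg _) hx

theorem norm_inclLp_resolvent_pow_le (hA : IsDirichletOperator (-(S.negPow α))) {s : ℝ} (hs : 0 < s) (k : ℕ) (f : L2 m) :
    ‖inclLp (p := 1) one_le_two ((S.resolvent α hs ^ k) f)‖ ≤
      ‖inclLp (p := 1) one_le_two f‖ := by
  induction k with
  | zero => simp
  | succ k ih =>
    rw [pow_succ', mul_apply_eq_comp]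
    exact (S.norm_inclLp_resolvent_le hA hs _).trans ih

end Markov

end EigenSystem
end FastDiffusion

/-! ### Smoothing from `L¹(m)` to `L²(m)` -/

namespace FastDiffusion
namespace EigenSystem

variable {E : Type*} [MeasurableSpace E] {m : Measure E}
variable {L : L2 m →ₗ.[ℝ] L2 m} {ι : Type*} (S : EigenSystem L ι)

theorem ev_rpow_pow {n : ℕ} (hn : 1 ≤ n) (i : ι) : (S.ev i ^ (1 / (n : ℝ))) ^ n = S.ev i := by
  rw [one_div]
  exact Real.rpow_inv_natCast_pow (S.ev_pos i).le (by omega)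

theorem ev_mul_inv_pow_le {n : ℕ} (hn : 1 ≤ n) {s : ℝ} (hs : 0 < s) (i : ι) :
    S.ev i * ((1 + s * S.ev i ^ (1 / (n : ℝ))) ^ n)⁻¹ ≤ (s ^ n)⁻¹ := by
  have h := S.one_le_one_add_mul (1 / (n : ℝ)) hs i
  have hμ := Real.rpow_pos_of_pos (S.ev_pos i) (1 / (n : ℝ))
  nth_rw 1 [← S.ev_rpow_pow hn i]
  rw [← div_eq_mul_inv, div_le_iff₀ (by positivity), ← div_eq_inv_mul, le_div_iff₀ (by positivity),
    ← mul_pow]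
  exact pow_le_pow_left₀ (by positivity) (by linarith) n

theorem abs_exp_neg_mul_ev_le (α : ℝ) {t : ℝ} (ht : 0 < t) (i : ι) :
    |Real.exp (-(t * S.ev i ^ α))| ≤ 1 := by
  rw [Real.abs_exp, Real.exp_le_one_iff, neg_nonpos]
  exact mul_nonneg ht.le (Real.rpow_nonneg (S.ev_pos i).le α)

/-- The heat operator `exp (-t (-L)^α)`. -/
def heat (α : ℝ) {t : ℝ} (ht : 0 < t) : L2 m →L[ℝ] L2 m :=
  S.basis.diagonal S.basis (fun i => Real.exp (-(t * S.ev i ^ α)))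
    ⟨1, S.abs_exp_neg_mul_ev_le α ht⟩

theorem repr_heat (α : ℝ) {t : ℝ} (ht : 0 < t) (f : L2 m) (i : ι) :
    S.basis.repr (S.heat α ht f) i = Real.exp (-(t * S.ev i ^ α)) * S.basis.repr f i :=
  HilbertBasis.repr_diagonal _ _ _ _ _

theorem norm_heat_le (α : ℝ) {t : ℝ} (ht : 0 < t) (f : L2 m) : ‖S.heat α ht f‖ ≤ ‖f‖ :=
  (HilbertBasis.norm_diagonal_apply_le S.basis S.basis
    ⟨1, S.abs_exp_neg_mul_ev_le α ht⟩ zero_le_one (S.abs_exp_neg_mul_ev_le α ht) f).trans_eq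
    (one_mul _)

/-- With `μ = λ_i^(1/n)`, the level `k` is chosen with `2^k` comparable to `max μ 1`. There the heat
factor at time `2^(-k)` is bounded below, while `λ_i^(-ε) = μ^(-nε)` is at most a constant times
`2^(-nεk)`. -/
theorem exists_dyadic_bound {n : ℕ} (hn : 1 ≤ n) {ε : ℝ} (hε : 0 < ε) :
    ∃ A : ℝ, 0 < A ∧ ∀ i, ∃ k : ℕ, S.ev i ^ (-ε) ≤
      A * (2 ^ (-(n * ε)) : ℝ) ^ k *
        Real.exp (-(((2 : ℝ) ^ k)⁻¹ * S.ev i ^ (1 / (n : ℝ)))) ^ 2 := by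
  obtain ⟨D, hD, h⟩ := S.exists_ev_rpow_le (α := -ε) (by linarith)
  have hn0 : (0 : ℝ) < n := by exact_mod_cast hn
  -- `max D 1` covers the finitely many eigenvalues with `μ ≤ 1`, and `exp 4` compensates the
  -- squared heat factor, since `2^(-k) μ ≤ 2`.
  refine ⟨max D 1 * Real.exp 4, by positivity, fun i => ?_⟩
  have hμ := Real.rpow_pos_of_pos (S.ev_pos i) (1 / (n : ℝ))
  have hev : S.ev i ^ (-ε) = (S.ev i ^ (1 / (n : ℝ))) ^ (-(n * ε)) := by
    rw [← Real.rpow_mul (S.ev_pos i).le]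
    congr 1
    field_simp
  have hi := h i
  rw [hev] at hi ⊢
  generalize S.ev i ^ (1 / (n : ℝ)) = μ at hμ hi ⊢
  obtain ⟨k, hk1, hk2⟩ := exists_nat_pow_near (le_max_right μ 1) one_lt_two
  refine ⟨k, ?_⟩
  have h1 : μ ^ (-(n * ε)) ≤ max D 1 * (max μ 1) ^ (-(n * ε)) := by
    rcases le_total μ 1 with hle | hle
    · rw [max_eq_right hle, Real.one_rpow, mul_one]
      exact hi.trans (le_max_left _ _)
    · rw [max_eq_left hle]
      exact le_mul_of_one_le_left (by positivity) (le_max_right _ _)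
  have h2 : (max μ 1) ^ (-(n * ε)) ≤ (2 ^ (-(n * ε)) : ℝ) ^ k := by
    rw [← Real.rpow_natCast, ← Real.rpow_mul (by norm_num), mul_comm _ (k : ℝ),
      Real.rpow_mul (by norm_num), Real.rpow_natCast]
    exact Real.rpow_le_rpow_of_nonpos (by positivity) hk1 (by nlinarith [mul_pos hn0 hε])
  have h3 : 1 ≤ Real.exp 4 * Real.exp (-(((2 : ℝ) ^ k)⁻¹ * μ)) ^ 2 := by
    rw [← Real.exp_nat_mul, ← Real.exp_add, Real.one_le_exp_iff]
    have : ((2 : ℝ) ^ k)⁻¹ * μ ≤ 2 := by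
      rw [inv_mul_le_iff₀ (by positivity), ← pow_succ]
      exact (le_max_left _ _).trans hk2.le
    push_cast
    linarith
  calc μ ^ (-(n * ε)) ≤ max D 1 * (2 ^ (-(n * ε)) : ℝ) ^ k :=
        h1.trans (mul_le_mul_of_nonneg_left h2 (by positivity))
    _ ≤ max D 1 * (2 ^ (-(n * ε)) : ℝ) ^ k *
        (Real.exp 4 * Real.exp (-(((2 : ℝ) ^ k)⁻¹ * μ)) ^ 2) :=
        le_mul_of_one_le_right (by positivity) h3
    _ = _ := by ring

variable [IsProbabilityMeasure m]

/-- The Nash inequality is applied to the smoothed function: its energy for `-L` is at most `s^(-n)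
‖x‖²` since `λ (1 + s λ^(1/n))^(-n) ≤ s^(-n)`, and its `L¹` norm is still at most `1`. -/
theorem exists_resolvent_smoothing (hL : IsSelfAdjoint L) {d : ℝ} (hd : 0 < d)
    (hN : NashInequality L d) {n : ℕ} (hn : 1 ≤ n)
    (hA : IsDirichletOperator (-(S.negPow (1 / (n : ℝ))))) :
    ∃ C : ℝ, 0 < C ∧ ∀ (s : ℝ) (hs : 0 < s) (x : L2 m), ‖inclLp (p := 1) one_le_two x‖ ≤ 1 →
      (‖(S.resolvent (1 / (n : ℝ)) hs ^ n) x‖ ^ 2) ^ (1 + 2 / d) ≤ C * ((s ^ n)⁻¹ * ‖x‖ ^ 2) := by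
  obtain ⟨C, hC, h⟩ := S.exists_nash hL hd hN
  refine ⟨C, hC, fun s hs x hx => ?_⟩
  set y := (S.resolvent (1 / (n : ℝ)) hs ^ n) x with hy
  have hrepr := S.repr_resolvent_pow (1 / (n : ℝ)) hs n x
  rw [← hy] at hrepr
  have hx2 := S.basis.hasSum_sq_repr x
  have hw0 : ∀ i, 0 ≤ ((1 + s * S.ev i ^ (1 / (n : ℝ))) ^ n)⁻¹ := fun i => by
    have := S.one_le_one_add_mul (1 / (n : ℝ)) hs i
    positivity
  have hw1 : ∀ i, ((1 + s * S.ev i ^ (1 / (n : ℝ))) ^ n)⁻¹ ≤ 1 := fun i =>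
    inv_le_one_of_one_le₀ (one_le_pow₀ (S.one_le_one_add_mul (1 / (n : ℝ)) hs i))
  have hw2 := fun i => S.ev_mul_inv_pow_le hn hs i
  have hsum : Summable fun i => (S.ev i * S.basis.repr y i) ^ 2 := by
    refine Summable.of_nonneg_of_le (fun i => sq_nonneg _) (fun i => ?_)
      (hx2.summable.mul_left ((s ^ n)⁻¹ ^ 2))
    rw [hrepr, ← mul_assoc, mul_pow]
    exact mul_le_mul_of_nonneg_right
      (pow_le_pow_left₀ (mul_nonneg (S.ev_pos i).le (hw0 i)) (hw2 i) 2) (sq_nonneg _)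
  have hle : ∀ i, S.ev i * S.basis.repr y i ^ 2 ≤ (s ^ n)⁻¹ * S.basis.repr x i ^ 2 := fun i => by
    rw [hrepr, mul_pow, ← mul_assoc]
    refine mul_le_mul_of_nonneg_right ?_ (sq_nonneg _)
    calc _ = (S.ev i * ((1 + s * S.ev i ^ (1 / (n : ℝ))) ^ n)⁻¹) *
          ((1 + s * S.ev i ^ (1 / (n : ℝ))) ^ n)⁻¹ := by ring
      _ ≤ (s ^ n)⁻¹ * 1 := mul_le_mul (hw2 i) (hw1 i) (hw0 i) (by positivity)
      _ = _ := mul_one _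
  have hE : ∑' i, S.ev i * S.basis.repr y i ^ 2 ≤ (s ^ n)⁻¹ * ‖x‖ ^ 2 := by
    rw [← hx2.tsum_eq, ← tsum_mul_left]
    exact Summable.tsum_le_tsum hle (Summable.of_nonneg_of_le
      (fun i => mul_nonneg (S.ev_pos i).le (sq_nonneg _)) hle (hx2.summable.mul_left _))
      (hx2.summable.mul_left _)
  have h1 := h y hsum ((S.norm_inclLp_resolvent_pow_le hA hs n x).trans hx)
  have h2 : (‖y‖ ^ 2) ^ (1 + 2 / d) = ‖y‖ ^ (2 + 4 / d) := by
    rw [← Real.rpow_natCast, ← Real.rpow_mul (norm_nonneg _)]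
    congr 1
    push_cast
    ring
  rw [h2]
  exact h1.trans (mul_le_mul_of_nonneg_left hE hC.le)

/-- Each smoothing step doubles the parameter and reproduces the same form of `L²` bound. Because `1
+ u ≤ exp u`, the product of the resolvent factors dominates a single exponential whose rate is the
sum of a geometric series, hence comparable to the last parameter. -/
theorem exists_iterated_smoothing (hL : IsSelfAdjoint L) {d : ℝ} (hd : 0 < d)
    (hN : NashInequality L d) {n : ℕ} (hn : 1 ≤ n)
    (hA : IsDirichletOperator (-(S.negPow (1 / (n : ℝ))))) :
    ∃ B : ℝ, 0 < B ∧ ∀ (N : ℕ) (s : ℝ) (f : L2 m), 0 < s → ‖inclLp (p := 1) one_le_two f‖ ≤ 1 →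
      ‖f‖ ^ 2 ≤ B * s ^ (-(n * d / 2)) →
      ∃ g : L2 m, ‖inclLp (p := 1) one_le_two g‖ ≤ 1 ∧
        ‖g‖ ^ 2 ≤ B * (2 ^ N * s) ^ (-(n * d / 2)) ∧
        ∀ i, Real.exp (-(2 * n * (2 ^ N * s) * S.ev i ^ (1 / (n : ℝ)))) * |S.basis.repr f i| ≤
          |S.basis.repr g i| := by
  obtain ⟨C, hC, h⟩ := S.exists_resolvent_smoothing hL hd hN hn hA
  set p : ℝ := n * d / 2 with hp
  -- `B` is the fixed point of the recursion, `C B 2^p = B^(1 + 2/d)`, so the constant does not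
  -- deteriorate under iteration.
  set B : ℝ := (C * 2 ^ p) ^ (d / 2) with hB
  have hB0 : 0 < B := by positivity
  have hBeq : C * B * 2 ^ p = B ^ (1 + 2 / d) := by
    rw [Real.rpow_add hB0, Real.rpow_one, hB, ← Real.rpow_mul (by positivity)]
    rw [show d / 2 * (2 / d) = 1 by field_simp, Real.rpow_one]
    ring
  refine ⟨B, hB0, fun N s f hs hf1 hf2 => ?_⟩
  induction N with
  | zero =>
    refine ⟨f, hf1, by simpa using hf2, fun i => ?_⟩
    refine mul_le_of_le_one_left (abs_nonneg _) ?_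
    rw [Real.exp_le_one_iff, neg_nonpos]
    have := Real.rpow_nonneg (S.ev_pos i).le (1 / (n : ℝ))
    positivity
  | succ N ih =>
    obtain ⟨g, hg1, hg2, hg3⟩ := ih
    set a : ℝ := 2 ^ N * s with ha
    have ha0 : 0 < a := by positivity
    have hpow : (2 : ℝ) ^ (N + 1) * s = 2 * a := by rw [ha]; ring
    rw [hpow]
    have h2a : 0 < 2 * a := by positivity
    refine ⟨(S.resolvent (1 / (n : ℝ)) h2a ^ n) g,
      (S.norm_inclLp_resolvent_pow_le hA h2a n g).trans hg1, ?_, fun i => ?_⟩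
    · have h1 := h (2 * a) h2a g hg1
      rw [← Real.rpow_le_rpow_iff (by positivity) (by positivity)
        (show (0 : ℝ) < 1 + 2 / d by positivity)]
      refine h1.trans ?_
      calc C * (((2 * a) ^ n)⁻¹ * ‖g‖ ^ 2) ≤ C * (((2 * a) ^ n)⁻¹ * (B * a ^ (-p))) := by gcongr
        _ = B ^ (1 + 2 / d) * (2 * a) ^ (-p * (1 + 2 / d)) := by
          have e1 : ((2 * a) ^ n)⁻¹ = (2 * a) ^ (-(n : ℝ)) := by
            rw [Real.rpow_neg h2a.le, Real.rpow_natCast]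
          have e2 : -p * (1 + 2 / d) = -(n : ℝ) + -p := by
            rw [hp]; field_simp; ring
          have e3 : (2 * a) ^ (-p) = (2 ^ p)⁻¹ * a ^ (-p) := by
            rw [Real.mul_rpow (by norm_num) ha0.le, Real.rpow_neg (by norm_num)]
          rw [e1, e2, Real.rpow_add h2a, e3, ← hBeq]
          have : (2 : ℝ) ^ p ≠ 0 := by positivity
          field_simp
        _ = (B * (2 * a) ^ (-p)) ^ (1 + 2 / d) := by
          rw [Real.mul_rpow hB0.le (by positivity), ← Real.rpow_mul h2a.le]
    · have hμ := Real.rpow_nonneg (S.ev_pos i).le (1 / (n : ℝ))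
      have hgi := hg3 i
      rw [S.repr_resolvent_pow]
      generalize S.ev i ^ (1 / (n : ℝ)) = μ at hμ hgi ⊢
      generalize (S.basis.repr f i : ℝ) = u at hgi ⊢
      generalize (S.basis.repr g i : ℝ) = v at hgi ⊢
      have habs : |((1 + 2 * a * μ) ^ n)⁻¹ * v| = ((1 + 2 * a * μ) ^ n)⁻¹ * |v| := by
        rw [abs_mul, abs_of_nonneg (by positivity)]
      rw [habs]
      -- Half of the exponent, `n (2a) μ`, pays for the new resolvent power; the other half, `2 n a
      -- μ`, is the induction hypothesis.
      calc Real.exp (-(2 * n * (2 * a) * μ)) * |u|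
          = Real.exp (-(n * (2 * a * μ))) *
            (Real.exp (-(2 * n * a * μ)) * |u|) := by
            rw [← mul_assoc (Real.exp _), ← Real.exp_add]
            congr 2
            ring
        _ ≤ ((1 + 2 * a * μ) ^ n)⁻¹ * |v| := by
            refine mul_le_mul ?_ hgi (by positivity) (by positivity)
            rw [Real.exp_neg, Real.exp_nat_mul]
            refine inv_anti₀ (by positivity) (pow_le_pow_left₀ (by positivity) ?_ n)
            rw [add_comm]
            exact Real.add_one_le_exp _

/-- The Nash inequality makes the heat operators bounded from `L¹(m)` to `L²(m)`. -/
theorem exists_norm_heat_le (hL : IsSelfAdjoint L) {d : ℝ} (hd : 0 < d)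
    (hN : NashInequality L d) {n : ℕ} (hn : 1 ≤ n)
    (hA : IsDirichletOperator (-(S.negPow (1 / (n : ℝ))))) :
    ∃ K : ℝ, 0 < K ∧ ∀ (t : ℝ) (ht : 0 < t) (f : L2 m),
      ‖S.heat (1 / (n : ℝ)) ht f‖ ≤
        K * t ^ (-(n * d / 4)) * ‖inclLp (p := 1) one_le_two f‖ := by
  obtain ⟨B, hB, h⟩ := S.exists_iterated_smoothing hL hd hN hn hA
  have hn0 : (0 : ℝ) < n := by exact_mod_cast hn
  have hp0 : 0 < n * d / 2 := by positivity
  have key : ∀ (t : ℝ) (ht : 0 < t) (f : L2 m), ‖inclLp (p := 1) one_le_two f‖ ≤ 1 →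
      ‖S.heat (1 / (n : ℝ)) ht f‖ ^ 2 ≤ B * (t / (2 * n)) ^ (-(n * d / 2)) := by
    intro t ht f hf
    set s := t / (2 * n) with hs
    have hs0 : 0 < s := by positivity
    -- Starting the iteration at `s / 2^N` with `N` large makes the initial `L²` requirement hold
    -- for this `f`; the final bound at `s` depends neither on `N` nor on `‖f‖₂`.
    have hlim : Tendsto (fun N : ℕ => B * (s / 2 ^ N) ^ (-(n * d / 2))) atTop atTop := by
      refine Tendsto.const_mul_atTop hB ?_
      have h2 : ∀ N : ℕ, (s / 2 ^ N) ^ (-(n * d / 2)) = s ^ (-(n * d / 2)) *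
          ((2 : ℝ) ^ N) ^ (n * d / 2) := fun N => by
        rw [Real.div_rpow hs0.le (by positivity), Real.rpow_neg (x := (2 : ℝ) ^ N) (by positivity),
          div_inv_eq_mul]
      simp only [h2]
      exact Tendsto.const_mul_atTop (by positivity) ((tendsto_rpow_atTop hp0).comp
        (tendsto_pow_atTop_atTop_of_one_lt one_lt_two))
    obtain ⟨N, hN'⟩ := (hlim.eventually_ge_atTop (‖f‖ ^ 2)).exists
    obtain ⟨g, -, hg2, hg3⟩ := h N (s / 2 ^ N) f (by positivity) hf hN'
    have hsN : 2 ^ N * (s / 2 ^ N) = s := by field_simp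
    rw [hsN] at hg2 hg3
    refine le_trans ?_ hg2
    refine pow_le_pow_left₀ (norm_nonneg _) ?_ 2
    rw [← one_mul ‖g‖]
    refine S.basis.norm_le_mul_norm_of_repr S.basis zero_le_one fun i => ?_
    rw [repr_heat, abs_mul, Real.abs_exp, one_mul]
    have : 2 * n * s = t := by rw [hs]; field_simp
    rw [← this]
    exact hg3 i
  refine ⟨√(B * (1 / (2 * n)) ^ (-(n * d / 2))), by positivity, fun t ht f => ?_⟩
  rcases eq_or_ne f 0 with rfl | hf0
  · simp
  set a := ‖inclLp (p := 1) one_le_two f‖ with ha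
  have hane : inclLp (p := 1) one_le_two f ≠ 0 := fun h0 =>
    hf0 (inclLp_injective one_le_two (h0.trans (map_zero _).symm))
  have ha0 : 0 < a := norm_pos_iff.2 hane
  have h1 := key t ht (a⁻¹ • f) (by
    rw [map_smul, norm_smul, ← ha, Real.norm_of_nonneg (by positivity), inv_mul_cancel₀ ha0.ne'])
  rw [map_smul, norm_smul, Real.norm_of_nonneg (by positivity)] at h1
  have h2 : B * (t / (2 * n)) ^ (-(n * d / 2)) =
      (√(B * (1 / (2 * n)) ^ (-(n * d / 2))) * t ^ (-(n * d / 4))) ^ 2 := by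
    rw [mul_pow, Real.sq_sqrt (by positivity), ← Real.rpow_natCast (t ^ _), ← Real.rpow_mul ht.le,
      mul_assoc, show -(n * d / 4) * ((2 : ℕ) : ℝ) = -(n * d / 2) by push_cast; ring,
      ← Real.mul_rpow (by positivity) ht.le, one_div_mul_eq_div]
  rw [h2] at h1
  have h3 := (abs_le_of_sq_le_sq' h1 (by positivity)).2
  rw [inv_mul_le_iff₀ ha0] at h3
  rwa [mul_comm _ a]

end EigenSystem
end FastDiffusion

/-! ### From `L¹(m)` to `L^(1+r)(m)`: interpolation and the Sobolev inequality -/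

namespace FastDiffusion

variable {E : Type*} [MeasurableSpace E] {m : Measure E}

theorem ofReal_add_one_le_two {r : ℝ} (hr : r < 1) : ENNReal.ofReal (r + 1) ≤ 2 := by
  rw [show (2 : ℝ≥0∞) = ENNReal.ofReal 2 by simp]
  exact ENNReal.ofReal_le_ofReal (by linarith)

variable [IsProbabilityMeasure m]

theorem integrable_abs_rpow {r : ℝ} (hr0 : 0 < r) (hr1 : r < 1) (f : L2 m) :
    Integrable (fun x => |f x| ^ (r + 1)) m := by
  have h := ((Lp.memLp f).mono_exponent (ofReal_add_one_le_two hr1)).integrable_norm_rpow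
    (by simpa using by linarith) ENNReal.ofReal_ne_top
  rwa [ENNReal.toReal_ofReal (by linarith)] at h

theorem integral_abs_rpow {r : ℝ} (hr0 : 0 < r) (hr1 : r < 1) (f : L2 m) :
    ∫ x, |f x| ^ (r + 1) ∂m = ‖inclLp (ofReal_add_one_le_two hr1) f‖ ^ (r + 1) := by
  have h := ((Lp.memLp f).mono_exponent (ofReal_add_one_le_two hr1))
  rw [Lp.norm_def, coeFn_inclLp, h.eLpNorm_eq_integral_rpow_norm
    (by simpa using by linarith) ENNReal.ofReal_ne_top, ENNReal.toReal_ofReal (Real.rpow_nonneg (integral_nonneg fun x => by positivity) _),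
    ENNReal.toReal_ofReal (by linarith),
    Real.rpow_inv_rpow (integral_nonneg fun x => by positivity) (by linarith)]
  rfl

/-- Splitting a function at height `a` into its large part, which is small in `L¹(m)`, and its
small part, which is bounded in `L²(m)`. -/
theorem exists_split {r : ℝ} (hr0 : 0 < r) (hr1 : r < 1) (f : L2 m) {a : ℝ} (ha : 0 < a) :
    ∃ g h : L2 m, f = g + h ∧
      ‖inclLp (p := 1) one_le_two g‖ ≤ a ^ (-r) * ∫ x, |f x| ^ (r + 1) ∂m ∧
      ‖h‖ ^ 2 ≤ a ^ (1 - r) * ∫ x, |f x| ^ (r + 1) ∂m := by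
  have hmeas : NullMeasurableSet {x | a < |f x|} m :=
    nullMeasurableSet_lt aemeasurable_const (Lp.aestronglyMeasurable f).aemeasurable.abs
  have hg : MemLp ({x | a < |f x|}.indicator f) 2 m := by
    refine (Lp.memLp f).mono ((Lp.aestronglyMeasurable f).indicator₀ hmeas) (ae_of_all _ fun x => ?_)
    exact norm_indicator_le_norm_self _ _
  have hint := integrable_abs_rpow hr0 hr1 f
  refine ⟨hg.toLp _, f - hg.toLp _, by abel, ?_, ?_⟩
  · rw [norm_inclLp_one, ← integral_const_mul]
    refine integral_mono_ae ((Lp.memLp _).integrable one_le_two).abs (hint.const_mul _) ?_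
    filter_upwards [hg.coeFn_toLp] with x hx
    rw [hx]
    by_cases h : a < |f x|
    · rw [Set.indicator_of_mem (by exact h)]
      have h1 : |f x| ^ (r + 1) = |f x| ^ r * |f x| := by
        rw [Real.rpow_add (ha.trans h), Real.rpow_one]
      have h2 : a ^ r ≤ |f x| ^ r := Real.rpow_le_rpow ha.le h.le hr0.le
      rw [h1, Real.rpow_neg ha.le, ← div_eq_inv_mul, le_div_iff₀ (by positivity), mul_comm]
      exact mul_le_mul_of_nonneg_right h2 (abs_nonneg _)
    · rw [Set.indicator_of_notMem (by exact h), abs_zero]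
      positivity
  · rw [← real_inner_self_eq_norm_sq, MeasureTheory.L2.inner_def, ← integral_const_mul]
    refine integral_mono_ae (L2.integrable_inner _ _) (hint.const_mul _) ?_
    filter_upwards [hg.coeFn_toLp, Lp.coeFn_sub f (hg.toLp _)] with x hx hs
    simp only [RCLike.inner_apply, conj_trivial]
    rw [hs, Pi.sub_apply, hx]
    by_cases h : a < |f x|
    · rw [Set.indicator_of_mem (by exact h)]
      simp only [sub_self, mul_zero]
      positivity
    · rw [Set.indicator_of_notMem (by exact h), sub_zero, ← abs_mul_abs_self]
      rcases (abs_nonneg (f x)).eq_or_lt with h0 | h0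
      · rw [← h0]
        simp only [mul_zero]
        positivity
      · have h1 : |f x| * |f x| = |f x| ^ (1 - r) * |f x| ^ (r + 1) := by
          rw [← Real.rpow_add h0, show 1 - r + (r + 1) = 2 by ring, Real.rpow_two, sq]
        rw [h1]
        exact mul_le_mul_of_nonneg_right
          (Real.rpow_le_rpow h0.le (not_lt.1 h) (by linarith)) (by positivity)

namespace EigenSystem

variable {L : L2 m →ₗ.[ℝ] L2 m} {ι : Type*} (S : EigenSystem L ι)

/-- The heat operators are bounded from `L^(1+r)(m)` to `L²(m)`, by real interpolation. -/
theorem exists_norm_heat_le_of_rpow (hL : IsSelfAdjoint L) {d : ℝ} (hd : 0 < d)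
    (hN : NashInequality L d) {n : ℕ} (hn : 1 ≤ n)
    (hA : IsDirichletOperator (-(S.negPow (1 / (n : ℝ))))) {r : ℝ} (hr0 : 0 < r) (hr1 : r < 1) :
    ∃ K : ℝ, 0 < K ∧ ∀ (t : ℝ) (ht : 0 < t) (f : L2 m),
      ‖inclLp (ofReal_add_one_le_two hr1) f‖ ≤ 1 →
      ‖S.heat (1 / (n : ℝ)) ht f‖ ≤ K * t ^ (-(n * d / 4 * (1 - r) / (1 + r))) := by
  obtain ⟨K, hK, h⟩ := S.exists_norm_heat_le hL hd hN hn hA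
  have := fact_one_le_ofReal hr0
  refine ⟨K + 1, by positivity, fun t ht f hf => ?_⟩
  have hr : 1 + r ≠ 0 := by positivity
  set γ : ℝ := n * d / 4 with hγ
  -- This height balances the two parts: `t^(-γ) a^(-r) = a^((1-r)/2)`.
  set a : ℝ := t ^ (-(2 * γ / (1 + r))) with ha
  have ha0 : 0 < a := by positivity
  have hM : ∫ x, |f x| ^ (r + 1) ∂m ≤ 1 := by
    rw [integral_abs_rpow hr0 hr1]
    exact Real.rpow_le_one (norm_nonneg _) hf (by positivity)
  obtain ⟨g, k, hgk, hg, hk⟩ := exists_split hr0 hr1 f ha0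
  have hg' : ‖inclLp (p := 1) one_le_two g‖ ≤ a ^ (-r) :=
    hg.trans (mul_le_of_le_one_right (by positivity) hM)
  have hk' : ‖k‖ ≤ t ^ (-(γ * (1 - r) / (1 + r))) := by
    refine (abs_le_of_sq_le_sq' ?_ (by positivity)).2
    refine (hk.trans (mul_le_of_le_one_right (by positivity) hM)).trans_eq ?_
    rw [ha, ← Real.rpow_natCast, ← Real.rpow_mul ht.le, ← Real.rpow_mul ht.le]
    congr 1
    push_cast
    field_simp
  have hprod : t ^ (-γ) * a ^ (-r) = t ^ (-(γ * (1 - r) / (1 + r))) := by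
    rw [ha, ← Real.rpow_mul ht.le, ← Real.rpow_add ht]
    congr 1
    field_simp
    ring
  calc ‖S.heat (1 / (n : ℝ)) ht f‖
      ≤ ‖S.heat (1 / (n : ℝ)) ht g‖ + ‖S.heat (1 / (n : ℝ)) ht k‖ := by
        rw [hgk, map_add]
        exact norm_add_le _ _
    _ ≤ K * t ^ (-γ) * a ^ (-r) + t ^ (-(γ * (1 - r) / (1 + r))) := by
        refine add_le_add ((h t ht g).trans ?_) ((S.norm_heat_le _ ht k).trans hk')
        gcongr
    _ = _ := by rw [mul_assoc, hprod]; ring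

/-- The subcritical Sobolev inequality: `(-L)^(-ε/2)` is bounded from `L^(1+r)(m)` to `L²(m)`. -/
theorem exists_sobolev (hL : IsSelfAdjoint L) {d : ℝ} (hd0 : 0 < d)
    (hN : NashInequality L d) {n : ℕ} (hn : 1 ≤ n)
    (hA : IsDirichletOperator (-(S.negPow (1 / (n : ℝ))))) {r : ℝ} (hr0 : 0 < r) (hr1 : r < 1)
    {ε : ℝ} (hε : 0 < ε) (hd : d < 2 * ε * (1 + r) / (1 - r)) :
    ∃ K : ℝ, 0 < K ∧ ∀ f : L2 m,
      ‖S.invPow (half_pos hε).le f‖ ≤ K * ‖inclLp (ofReal_add_one_le_two hr1) f‖ := by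
  have := fact_one_le_ofReal hr0
  obtain ⟨K, hK, h⟩ := S.exists_norm_heat_le_of_rpow hL hd0 hN hn hA hr0 hr1
  obtain ⟨A, hA0, hdy⟩ := S.exists_dyadic_bound hn hε
  have hn0 : (0 : ℝ) < n := by exact_mod_cast hn
  set κ : ℝ := n * d / 4 * (1 - r) / (1 + r) with hκ
  have hκε : 2 * κ < n * ε := by
    rw [lt_div_iff₀ (by linarith)] at hd
    have : κ * (1 + r) = n * d / 4 * (1 - r) := by rw [hκ]; field_simp
    nlinarith
  -- Ratio of the dyadic series: `2^(-nε)` comes from the weight and `2^(2κ)` from the squared heat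
  -- bound at time `2^(-j)`.
  set ρ : ℝ := 2 ^ (2 * κ - n * ε) with hρ
  have hρ0 : 0 < ρ := by positivity
  have hρ1 : ρ < 1 := Real.rpow_lt_one_of_one_lt_of_neg one_lt_two (by linarith)
  have hgeo := summable_geometric_of_lt_one hρ0.le hρ1
  have hM0 : 0 < ∑' k : ℕ, ρ ^ k := by
    rw [tsum_geometric_of_lt_one hρ0.le hρ1]
    exact inv_pos.2 (by linarith)
  set M : ℝ := A * (K ^ 2 * ∑' k : ℕ, ρ ^ k) with hM
  have hMpos : 0 < M := by positivity
  choose k hk using hdy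
  have key : ∀ f : L2 m, ‖inclLp (ofReal_add_one_le_two hr1) f‖ ≤ 1 →
      ‖S.invPow (half_pos hε).le f‖ ≤ √M := by
    intro f hf
    refine Real.le_sqrt_of_sq_le ?_
    -- On a finite set of indices only finitely many dyadic levels occur, so the sums may be
    -- interchanged freely; the bound is uniform in the set.
    refine hasSum_le_of_sum_le (S.basis.hasSum_sq_repr _) fun F => ?_
    have ht : ∀ j : ℕ, (0 : ℝ) < ((2 : ℝ) ^ j)⁻¹ := fun j => by positivity
    calc ∑ i ∈ F, S.basis.repr (S.invPow (half_pos hε).le f) i ^ 2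
        ≤ ∑ i ∈ F, ∑ j ∈ Finset.range (F.sup k + 1), A * ((2 ^ (-(n * ε)) : ℝ) ^ j *
            S.basis.repr (S.heat (1 / (n : ℝ)) (ht j) f) i ^ 2) := by
          refine Finset.sum_le_sum fun i hi => ?_
          refine le_trans ?_ (Finset.single_le_sum (fun j _ => by positivity)
            (Finset.mem_range_succ_iff.2 (Finset.le_sup hi) :
              k i ∈ Finset.range (F.sup k + 1)))
          rw [repr_invPow, repr_heat, mul_pow, mul_pow, ← mul_assoc, ← mul_assoc]
          refine mul_le_mul_of_nonneg_right (le_trans (le_of_eq ?_) (hk i)) (sq_nonneg _)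
          rw [← Real.rpow_natCast, ← Real.rpow_mul (S.ev_pos i).le]
          congr 1
          push_cast
          ring
      _ = A * ∑ j ∈ Finset.range (F.sup k + 1), (2 ^ (-(n * ε)) : ℝ) ^ j *
            ∑ i ∈ F, S.basis.repr (S.heat (1 / (n : ℝ)) (ht j) f) i ^ 2 := by
          rw [Finset.sum_comm, Finset.mul_sum]
          refine Finset.sum_congr rfl fun j _ => ?_
          rw [Finset.mul_sum, Finset.mul_sum]
      _ ≤ A * ∑ j ∈ Finset.range (F.sup k + 1), K ^ 2 * ρ ^ j := by
          refine mul_le_mul_of_nonneg_left (Finset.sum_le_sum fun j _ => ?_) hA0.le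
          have h1 : ∑ i ∈ F, S.basis.repr (S.heat (1 / (n : ℝ)) (ht j) f) i ^ 2 ≤
              (K * (((2 : ℝ) ^ j)⁻¹) ^ (-κ)) ^ 2 :=
            (sum_le_hasSum F (fun i _ => sq_nonneg _) (S.basis.hasSum_sq_repr _)).trans
              (pow_le_pow_left₀ (norm_nonneg _) (h _ (ht j) f hf) 2)
          refine (mul_le_mul_of_nonneg_left h1 (by positivity)).trans_eq ?_
          have h2 : (((2 : ℝ) ^ j)⁻¹) ^ (-κ) = (2 ^ κ) ^ j := by
            rw [Real.inv_rpow (by positivity), Real.rpow_neg (by positivity), inv_inv,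
              ← Real.rpow_natCast, ← Real.rpow_natCast, ← Real.rpow_mul (by norm_num),
              ← Real.rpow_mul (by norm_num), mul_comm]
          have h3 : ρ = 2 ^ (-(n * ε)) * (2 ^ κ) ^ 2 := by
            rw [hρ, ← Real.rpow_natCast, ← Real.rpow_mul (by norm_num),
              ← Real.rpow_add (by norm_num)]
            congr 1
            push_cast
            ring
          rw [h2, h3, mul_pow, mul_pow, ← pow_mul, ← pow_mul]
          ring
      _ ≤ M := by
          rw [← Finset.mul_sum, hM]
          gcongr
          exact hgeo.sum_le_tsum _ fun j _ => by positivity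
  refine ⟨√M, by positivity, fun f => ?_⟩
  rcases eq_or_ne f 0 with rfl | hf0
  · simp
  set a := ‖inclLp (ofReal_add_one_le_two hr1) f‖ with ha
  have hane : inclLp (ofReal_add_one_le_two hr1) f ≠ 0 := fun h0 =>
    hf0 (inclLp_injective (ofReal_add_one_le_two hr1) (h0.trans (map_zero _).symm))
  have ha0 : 0 < a := norm_pos_iff.2 hane
  have h1 := key (a⁻¹ • f) (by
    rw [map_smul, norm_smul, ← ha, Real.norm_of_nonneg (by positivity), inv_mul_cancel₀ ha0.ne'])
  rw [map_smul, norm_smul, Real.norm_of_nonneg (by positivity), inv_mul_le_iff₀ ha0] at h1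
  rwa [mul_comm]

end EigenSystem
end FastDiffusion

/-! ### Coordinates in `H`, the operator `Q` and the `Q`-norm -/

namespace FastDiffusion
namespace EigenSystem

variable {E : Type*} [MeasurableSpace E] {m : Measure E}
variable {L : L2 m →ₗ.[ℝ] L2 m} {ι : Type*} (S : EigenSystem L ι)

theorem exists_norm_toH_le : ∃ K : ℝ, ∀ x : L2 m, ‖S.toH x‖ ≤ K * ‖x‖ := by
  obtain ⟨K, hK⟩ := S.exists_inv_ev_le
  refine ⟨√(max K 0), fun x => (abs_le_of_sq_le_sq' ?_ (by positivity)).2⟩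
  rw [mul_pow, Real.sq_sqrt (le_max_right _ _), ← real_inner_self_eq_norm_sq, inner_toH]
  refine hasSum_le (fun i => ?_) (S.summable_innerH x x).hasSum
    ((S.basis.hasSum_sq_repr x).mul_left (max K 0))
  rw [S.basis.repr_apply_apply, real_inner_comm, ← sq]
  exact mul_le_mul_of_nonneg_right ((hK i).trans (le_max_left _ _)) (sq_nonneg _)

theorem innerH_basis (i : ι) (x : L2 m) :
    S.innerH (S.basis i) x = (S.ev i)⁻¹ * S.basis.repr x i := by
  classical
  have h := orthonormal_iff_ite.1 S.basis.orthonormal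
  rw [innerH, tsum_eq_single i fun j hj => by rw [h, if_neg hj.symm]; simp]
  rw [h, if_pos rfl, one_mul, S.basis.repr_apply_apply, real_inner_comm]

theorem orthonormal_toH : Orthonormal ℝ fun i => √(S.ev i) • S.toH (S.basis i) := by
  classical
  rw [orthonormal_iff_ite]
  intro i j
  rw [real_inner_smul_left, real_inner_smul_right, inner_toH, innerH_basis, S.basis.repr_apply_apply,
    orthonormal_iff_ite.1 S.basis.orthonormal]
  split_ifs with h
  · subst h
    rw [mul_one, ← mul_assoc, Real.mul_self_sqrt (S.ev_pos i).le, mul_inv_cancel₀ (S.ev_pos i).ne']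
  · simp

theorem denseRange_toH : DenseRange S.toH :=
  (UniformSpace.Completion.denseRange_coe (α := S.PreH)).comp S.toPreH.surjective.denseRange
    (UniformSpace.Completion.continuous_coe _)

/-- Continuity of `L²(m) → H` makes the preimage of the closed span a closed subspace containing
every `e_i`, hence all of `L²(m)`; density of `L²(m)` in `H` finishes. -/
theorem top_le_closure_span_toH :
    ⊤ ≤ (Submodule.span ℝ
      (Set.range fun i => √(S.ev i) • S.toH (S.basis i))).topologicalClosure := by
  set V := (Submodule.span ℝ
      (Set.range fun i => √(S.ev i) • S.toH (S.basis i))).topologicalClosure with hV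
  have hVc : IsClosed (V : Set S.H) := Submodule.isClosed_topologicalClosure _
  let T : L2 m →L[ℝ] S.H := S.toH.mkContinuousOfExistsBound S.exists_norm_toH_le
  have h1 : Submodule.span ℝ (Set.range S.basis) ≤ V.comap T.toLinearMap := by
    rw [Submodule.span_le]
    rintro _ ⟨i, rfl⟩
    have h2 : √(S.ev i) • S.toH (S.basis i) ∈ V :=
      Submodule.le_topologicalClosure _ (Submodule.subset_span ⟨i, rfl⟩)
    have h3 : S.toH (S.basis i) = (√(S.ev i))⁻¹ • (√(S.ev i) • S.toH (S.basis i)) := by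
      rw [smul_smul, inv_mul_cancel₀ (Real.sqrt_pos.2 (S.ev_pos i)).ne', one_smul]
    change S.toH (S.basis i) ∈ V
    rw [h3]
    exact V.smul_mem _ h2
  have h2 : (⊤ : Submodule ℝ (L2 m)) ≤ V.comap T.toLinearMap := by
    rw [← S.basis.dense_span]
    exact Submodule.topologicalClosure_minimal _ h1 (hVc.preimage T.continuous)
  intro y _
  exact S.denseRange_toH.induction_on (p := fun y => y ∈ V) y hVc
    fun x => h2 (Submodule.mem_top (x := x))

/-- The orthonormal basis `λ_i^(1/2) e_i` of `H`. -/
def basisH : HilbertBasis ι ℝ S.H :=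
  HilbertBasis.mk S.orthonormal_toH S.top_le_closure_span_toH

theorem basisH_apply (i : ι) : S.basisH i = √(S.ev i) • S.toH (S.basis i) :=
  congrFun (HilbertBasis.coe_mk S.orthonormal_toH S.top_le_closure_span_toH) i

theorem toH_basis (i : ι) : S.toH (S.basis i) = (√(S.ev i))⁻¹ • S.basisH i := by
  rw [basisH_apply, smul_smul, inv_mul_cancel₀ (Real.sqrt_pos.2 (S.ev_pos i)).ne', one_smul]

theorem repr_toH (x : L2 m) (i : ι) :
    S.basisH.repr (S.toH x) i = (√(S.ev i))⁻¹ * S.basis.repr x i := by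
  rw [S.basisH.repr_apply_apply, basisH_apply, real_inner_smul_left, inner_toH, innerH_basis,
    ← mul_assoc]
  congr 1
  have := Real.sqrt_pos.2 (S.ev_pos i)
  nth_rw 2 [← Real.mul_self_sqrt (S.ev_pos i).le]
  field_simp

section Diagonal

variable {q : ι → ℝ}

theorem exists_abs_mul_inv_sqrt_le (hq : Summable fun i => q i ^ 2 / S.ev i) :
    ∃ K : ℝ, ∀ i, |q i * (√(S.ev i))⁻¹| ≤ K := by
  refine ⟨√(∑' i, q i ^ 2 / S.ev i), fun i => Real.abs_le_sqrt ?_⟩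
  have h : (q i * (√(S.ev i))⁻¹) ^ 2 = q i ^ 2 / S.ev i := by
    rw [mul_pow, inv_pow, Real.sq_sqrt (S.ev_pos i).le, div_eq_mul_inv]
  rw [h]
  exact hq.le_tsum i fun j _ => div_nonneg (sq_nonneg _) (S.ev_pos j).le

theorem isDiagonal_iff (hq : Summable fun i => q i ^ 2 / S.ev i) (Q : L2 m →L[ℝ] S.H) :
    S.IsDiagonal q Q ↔ Q = S.basis.diagonal S.basisH (fun i => q i * (√(S.ev i))⁻¹)
      (S.exists_abs_mul_inv_sqrt_le hq) := by
  have hD : S.IsDiagonal q (S.basis.diagonal S.basisH (fun i => q i * (√(S.ev i))⁻¹)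
      (S.exists_abs_mul_inv_sqrt_le hq)) := fun i => by
    rw [HilbertBasis.diagonal_apply_basis, toH_basis, smul_smul]
  refine ⟨fun h => ?_, fun h => h ▸ hD⟩
  refine ContinuousLinearMap.ext_on (s := Set.range S.basis) ?_ ?_
  · exact Submodule.dense_iff_topologicalClosure_eq_top.2 S.basis.dense_span
  · rintro _ ⟨i, rfl⟩
    rw [h i, hD i]

theorem repr_of_isDiagonal (hq : Summable fun i => q i ^ 2 / S.ev i) {Q : L2 m →L[ℝ] S.H}
    (hQ : S.IsDiagonal q Q) (y : L2 m) (i : ι) :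
    S.basisH.repr (Q y) i = q i * (√(S.ev i))⁻¹ * S.basis.repr y i := by
  rw [(S.isDiagonal_iff hq Q).1 hQ, HilbertBasis.repr_diagonal]

theorem isHilbertSchmidt_of_isDiagonal (hq : Summable fun i => q i ^ 2 / S.ev i)
    {Q : L2 m →L[ℝ] S.H} (hQ : S.IsDiagonal q Q) : S.IsHilbertSchmidt Q := by
  refine hq.congr fun i => ?_
  rw [hQ i, toH_basis, smul_smul, norm_smul, S.basisH.orthonormal.1 i, mul_one, Real.norm_eq_abs,
    sq_abs, mul_pow, inv_pow, Real.sq_sqrt (S.ev_pos i).le, div_eq_mul_inv]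

/-- The interpolation inequality behind the bound of `‖·‖_Q`. -/
theorem exists_preimage_norm_le (hq : Summable fun i => q i ^ 2 / S.ev i) {Q : L2 m →L[ℝ] S.H}
    (hQ : S.IsDiagonal q Q) {ε c : ℝ} (hc : 0 < c) {σ : ℝ} (hσ : 2 < σ)
    (hqc : ∀ i, c * S.ev i ^ ((σ + 2 * ε - 2) / (2 * σ)) ≤ q i) {y : L2 m} {w : S.H}
    (hw : ∀ i, S.basisH.repr w i = S.ev i ^ ((ε - 1) / 2) * S.basis.repr y i) :
    ∃ z : L2 m, Q z = w ∧ c ^ σ * ‖z‖ ^ σ ≤ ‖y‖ ^ 2 * ‖w‖ ^ (σ - 2) := by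
  have hσ0 : 0 < σ := by linarith
  -- This weight makes Hölder's bound, raised to the power `σ/2`, come out as `‖w‖^(σ-2) ‖y‖²`.
  set θ : ℝ := 2 / σ with hθ
  have hθ0 : 0 < θ := by positivity
  have hθ1 : θ < 1 := (div_lt_one hσ0).2 hσ
  have hy := S.basis.hasSum_sq_repr y
  have hw2 := S.basisH.hasSum_sq_repr w
  obtain ⟨hs, hle⟩ := tsum_rpow_mul_rpow_le (fun i => sq_nonneg (S.basisH.repr w i))
    (fun i => sq_nonneg (S.basis.repr y i)) hw2.summable hy.summable hθ0 hθ1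
  rw [hw2.tsum_eq, hy.tsum_eq] at hle
  have hq0 : ∀ i, 0 < q i := fun i =>
    (mul_pos hc (Real.rpow_pos_of_pos (S.ev_pos i) _)).trans_le (hqc i)
  -- Coefficients forced by `Q z = w`: `λ_i^((ε-1)/2)` divided by `q_i λ_i^(-1/2)`.
  set b : ι → ℝ := fun i => S.ev i ^ (ε / 2) / q i * S.basis.repr y i with hb
  have hbi : ∀ i, c ^ 2 * b i ^ 2 ≤
      (S.basisH.repr w i ^ 2) ^ (1 - θ) * (S.basis.repr y i ^ 2) ^ θ := fun i => by
    have hl := S.ev_pos i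
    have h1 : c * (S.ev i ^ (ε / 2) / q i) ≤ S.ev i ^ ((ε - 1) / 2 * (1 - θ)) := by
      rw [← mul_div_assoc, div_le_iff₀ (hq0 i)]
      have h2 : S.ev i ^ (ε / 2) = S.ev i ^ ((ε - 1) / 2 * (1 - θ)) *
          S.ev i ^ ((σ + 2 * ε - 2) / (2 * σ)) := by
        rw [← Real.rpow_add hl]
        congr 1
        rw [hθ]
        field_simp
        ring
      calc c * S.ev i ^ (ε / 2) = S.ev i ^ ((ε - 1) / 2 * (1 - θ)) *
            (c * S.ev i ^ ((σ + 2 * ε - 2) / (2 * σ))) := by rw [h2]; ring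
        _ ≤ _ := mul_le_mul_of_nonneg_left (hqc i) (by positivity)
    simp only [hw i, hb]
    generalize (S.basis.repr y i : ℝ) = u
    have h3 : (S.ev i ^ ((ε - 1) / 2)) ^ 2 = S.ev i ^ (ε - 1) := by
      rw [← Real.rpow_natCast, ← Real.rpow_mul hl.le]
      congr 1
      push_cast
      ring
    have h4 : ((S.ev i ^ ((ε - 1) / 2)) ^ 2) ^ (1 - θ) =
        (S.ev i ^ ((ε - 1) / 2 * (1 - θ))) ^ 2 := by
      rw [h3, ← Real.rpow_mul hl.le, ← Real.rpow_natCast, ← Real.rpow_mul hl.le]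
      congr 1
      push_cast
      ring
    rw [mul_pow (S.ev i ^ ((ε - 1) / 2)), Real.mul_rpow (by positivity) (sq_nonneg _), mul_assoc,
      ← Real.rpow_add' (sq_nonneg _) (by norm_num), sub_add_cancel, Real.rpow_one, h4, mul_pow,
      ← mul_assoc, ← mul_pow]
    have := hq0 i
    exact mul_le_mul_of_nonneg_right (pow_le_pow_left₀ (by positivity) h1 2) (sq_nonneg _)
  have hbs : Summable fun i => b i ^ 2 := by
    have := Summable.of_nonneg_of_le (fun i => by positivity) hbi hs
    exact (summable_mul_left_iff (by positivity)).1 this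
  obtain ⟨z, hz⟩ := S.basis.exists_repr_eq hbs
  refine ⟨z, S.basisH.ext_repr fun i => ?_, ?_⟩
  · rw [S.repr_of_isDiagonal hq hQ, hz, hw, hb]
    have := hq0 i
    have h5 : S.ev i ^ ((ε - 1) / 2) = (√(S.ev i))⁻¹ * S.ev i ^ (ε / 2) := by
      rw [Real.sqrt_eq_rpow, ← Real.rpow_neg (S.ev_pos i).le, ← Real.rpow_add (S.ev_pos i)]
      congr 1
      ring
    rw [h5]
    field_simp
  · have hzb : c ^ 2 * ‖z‖ ^ 2 ≤ (‖w‖ ^ 2) ^ (1 - θ) * (‖y‖ ^ 2) ^ θ := by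
      refine le_trans ?_ hle
      rw [← (S.basis.hasSum_sq_repr z).tsum_eq, ← tsum_mul_left]
      simp only [hz]
      exact Summable.tsum_le_tsum hbi (hbs.mul_left _) hs
    have h6 := Real.rpow_le_rpow (by positivity) hzb (show 0 ≤ σ / 2 by positivity)
    have h7 : ∀ a : ℝ, 0 ≤ a → (a ^ 2) ^ (σ / 2) = a ^ σ := fun a ha => by
      rw [← Real.rpow_natCast, ← Real.rpow_mul ha]
      congr 1
      push_cast
      ring
    have h8 : ((‖w‖ ^ 2) ^ (1 - θ)) ^ (σ / 2) = ‖w‖ ^ (σ - 2) := by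
      rw [← Real.rpow_natCast, ← Real.rpow_mul (norm_nonneg _), ← Real.rpow_mul (norm_nonneg _)]
      congr 1
      rw [hθ]
      field_simp
      push_cast
      ring
    have h9 : ((‖y‖ ^ 2) ^ θ) ^ (σ / 2) = ‖y‖ ^ 2 := by
      rw [← Real.rpow_mul (by positivity), hθ, show 2 / σ * (σ / 2) = 1 by field_simp,
        Real.rpow_one]
    rw [Real.mul_rpow (by positivity) (by positivity), Real.mul_rpow (by positivity) (by positivity),
      h7 c hc.le, h7 _ (norm_nonneg _), h8, h9] at h6
    rwa [mul_comm (‖y‖ ^ 2)]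

end Diagonal

/-! ### Injectivity of the extension of `(-L)^(-β)` -/

/-- Dominated convergence in the coefficients as `s → 0`: each multiplier `1 - (1 + s λ_i^α)^(-k)`
lies in `[0, 1]` and tends to `0`. -/
theorem exists_norm_sub_resolvent_pow_le (α : ℝ) (k : ℕ) (f : L2 m) {δ : ℝ} (hδ : 0 < δ) :
    ∃ (s : ℝ) (hs : 0 < s), ‖f - (S.resolvent α hs ^ k) f‖ ≤ δ := by
  have hf := S.basis.hasSum_sq_repr f
  have hlim : Tendsto (fun s : ℝ => ∑' i, (1 - ((1 + s * S.ev i ^ α) ^ k)⁻¹) ^ 2 *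
      S.basis.repr f i ^ 2) (𝓝[>] 0) (𝓝 (∑' i, (1 - ((1 + 0 * S.ev i ^ α) ^ k)⁻¹) ^ 2 *
      S.basis.repr f i ^ 2)) := by
    refine tendsto_tsum_of_dominated_convergence hf.summable (fun i => ?_) ?_
    · refine (Tendsto.mono_left ?_ nhdsWithin_le_nhds)
      have : ContinuousAt (fun s : ℝ => (1 - ((1 + s * S.ev i ^ α) ^ k)⁻¹) ^ 2 *
          S.basis.repr f i ^ 2) 0 := by
        refine ContinuousAt.mul (ContinuousAt.pow (continuousAt_const.sub
          (ContinuousAt.inv₀ (by fun_prop) (by simp))) 2) continuousAt_const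
      exact this
    · filter_upwards [self_mem_nhdsWithin] with s hs i
      have h1 := one_le_pow₀ (n := k) (S.one_le_one_add_mul α hs i)
      have h2 := inv_le_one_of_one_le₀ h1
      have h3 : 0 ≤ ((1 + s * S.ev i ^ α) ^ k)⁻¹ := by positivity
      rw [Real.norm_of_nonneg (by positivity)]
      refine mul_le_of_le_one_left (sq_nonneg _) ?_
      exact pow_le_one₀ (by linarith) (by linarith)
  simp only [zero_mul, add_zero, one_pow, inv_one, sub_self, ne_eq, OfNat.ofNat_ne_zero,
    not_false_eq_true, zero_pow, tsum_zero] at hlim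
  obtain ⟨s, hsle, hs⟩ := ((hlim.eventually (ge_mem_nhds (show 0 < δ ^ 2 by positivity))).and
    self_mem_nhdsWithin).exists
  refine ⟨s, hs, (abs_le_of_sq_le_sq' (le_trans (le_of_eq ?_) hsle) hδ.le).2⟩
  rw [← (S.basis.hasSum_sq_repr _).tsum_eq]
  refine tsum_congr fun i => ?_
  rw [map_sub, lp.coeFn_sub, Pi.sub_apply, repr_resolvent_pow]
  ring

/-- The resolvent power gains a full order of `-L`, which absorbs `(-L)^β` because `β ≤ 1` and the
eigenvalues are bounded away from `0`. The resulting `T` is therefore small on functions whose image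
under `(-L)^(-β)` is small. -/
theorem exists_norm_resolvent_pow_le {n : ℕ} (hn : 1 ≤ n) {s : ℝ} (hs : 0 < s) {β : ℝ}
    (hβ0 : 0 ≤ β) (hβ : β ≤ 1) :
    ∃ C : ℝ, 0 < C ∧ ∀ f : L2 m,
      ‖(S.resolvent (1 / (n : ℝ)) hs ^ n) f‖ ≤ C * ‖S.invPow hβ0 f‖ := by
  obtain ⟨D, hD, h⟩ := S.exists_ev_rpow_le (α := β - 1) (by linarith)
  refine ⟨(s ^ n)⁻¹ * D, by positivity, fun f => ?_⟩
  refine S.basis.norm_le_mul_norm_of_repr S.basis (by positivity) fun i => ?_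
  have hl := S.ev_pos i
  have h0 : 0 < 1 + s * S.ev i ^ (1 / (n : ℝ)) := by positivity
  rw [repr_resolvent_pow, repr_invPow, abs_mul, abs_mul, abs_of_nonneg (by positivity),
    abs_of_nonneg (Real.rpow_nonneg hl.le _), ← mul_assoc]
  refine mul_le_mul_of_nonneg_right ?_ (abs_nonneg _)
  have h1 := S.ev_mul_inv_pow_le hn hs i
  calc ((1 + s * S.ev i ^ (1 / (n : ℝ))) ^ n)⁻¹
      = (S.ev i * ((1 + s * S.ev i ^ (1 / (n : ℝ))) ^ n)⁻¹) *
        (S.ev i ^ (β - 1) * S.ev i ^ (-β)) := by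
        rw [← Real.rpow_add hl, show β - 1 + -β = -1 by ring, Real.rpow_neg_one]
        field_simp
    _ ≤ (s ^ n)⁻¹ * (D * S.ev i ^ (-β)) := by
        refine mul_le_mul h1 (mul_le_mul_of_nonneg_right (h i) (by positivity)) (by positivity)
          (by positivity)
    _ = _ := by ring

variable [IsProbabilityMeasure m]

/-- An extension of `(-L)^(-β)` to `L^p(m)` is injective when the resolvents contract `L¹(m)`. -/
theorem injective_of_extends_invPow {n : ℕ} (hn : 1 ≤ n)
    (hA : IsDirichletOperator (-(S.negPow (1 / (n : ℝ))))) {β : ℝ} (hβ0 : 0 ≤ β) (hβ : β ≤ 1)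
    {p : ℝ≥0∞} [hp1 : Fact (1 ≤ p)] (hp : p ≤ 2) (J : Lp ℝ p m →L[ℝ] L2 m)
    (hJ : ∀ f, J (inclLp hp f) = S.invPow hβ0 f) : Function.Injective J := by
  rw [injective_iff_map_eq_zero]
  intro x hx
  have hdense := denseRange_inclLp (m := m) (ne_top_of_le_ne_top ENNReal.ofNat_ne_top hp) hp
  have happrox : ∀ δ : ℝ, 0 < δ → ∃ f : L2 m, ‖x - inclLp hp f‖ < δ := fun δ hδ => by
    obtain ⟨f, hf⟩ := hdense.exists_dist_lt x hδ
    exact ⟨f, by rwa [← dist_eq_norm]⟩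
  have h1 : ‖inclLp hp1.out x‖ = 0 := by
    refine le_antisymm (le_of_forall_pos_le_add fun η hη => ?_) (norm_nonneg _)
    -- The order of choices matters: `f` first, then `s` depending on `f`, then `g` close enough to
    -- `x` to beat the constant `C` depending on `s`. Since `J x = 0`, `J g` and hence `T g` are
    -- small.
    obtain ⟨f, hf⟩ := happrox (η / 5) (by positivity)
    obtain ⟨s, hs, hfs⟩ := S.exists_norm_sub_resolvent_pow_le (1 / (n : ℝ)) n f
      (show 0 < η / 5 by positivity)
    obtain ⟨C, hC, hCle⟩ := S.exists_norm_resolvent_pow_le hn hs hβ0 hβ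
    obtain ⟨g, hg⟩ := happrox (min (η / 5) (η / 5 / (C * (‖J‖ + 1)))) (by positivity)
    set T := S.resolvent (1 / (n : ℝ)) hs ^ n with hT
    have hg1 := hg.trans_le (min_le_left _ _)
    have hg2 := hg.trans_le (min_le_right _ _)
    have hTg : ‖T g‖ ≤ η / 5 := by
      refine (hCle g).trans ?_
      rw [← hJ]
      have h2 : ‖J (inclLp hp g)‖ ≤ (‖J‖ + 1) * ‖x - inclLp hp g‖ := by
        have h3 : J (inclLp hp g) = -(J (x - inclLp hp g)) := by rw [map_sub, hx]; simp
        rw [h3, norm_neg]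
        refine (J.le_opNorm _).trans ?_
        gcongr
        linarith
      rw [lt_div_iff₀ (by positivity)] at hg2
      calc C * ‖J (inclLp hp g)‖ ≤ C * ((‖J‖ + 1) * ‖x - inclLp hp g‖) := by gcongr
        _ ≤ η / 5 := by linarith
    let I := inclLp (m := m) (p := 1) one_le_two
    have hxf : ‖inclLp hp1.out (x - inclLp hp f)‖ ≤ η / 5 := (norm_inclLp_le _ _).trans hf.le
    have hxg : ‖inclLp hp1.out (x - inclLp hp g)‖ ≤ η / 5 := (norm_inclLp_le _ _).trans hg1.le
    -- The third term costs `2η/5`, by `L¹` contractivity of `T`, and each of the others `η/5`.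
    have e : inclLp hp1.out x = inclLp hp1.out (x - inclLp hp f) + I (f - T f) + I (T (f - g)) +
        I (T g) := by
      simp only [map_sub, inclLp_inclLp, I]
      abel
    have hfg : ‖I (T (f - g))‖ ≤ η / 5 + η / 5 := by
      refine (S.norm_inclLp_resolvent_pow_le hA hs n _).trans ?_
      have e2 : inclLp (p := 1) one_le_two (f - g) =
          inclLp hp1.out (x - inclLp hp g) - inclLp hp1.out (x - inclLp hp f) := by
        simp only [map_sub, inclLp_inclLp]
        abel
      rw [e2]
      exact (norm_sub_le _ _).trans (add_le_add hxg hxf)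
    rw [e]
    refine (norm_add₄_le).trans ?_
    have h4 := (norm_inclLp_le (m := m) one_le_two (f - T f)).trans hfs
    have h5 := (norm_inclLp_le (m := m) one_le_two (T g)).trans hTg
    linarith
  exact inclLp_injective hp1.out ((norm_eq_zero.1 h1).trans (map_zero _).symm)

end EigenSystem
end FastDiffusion

end

/-! ### Factorization of the embedding and conclusion -/

theorem corollary3p2 {E : Type*} [MeasurableSpace E] (m : MeasureTheory.Measure E)
    [MeasureTheory.IsProbabilityMeasure m]
    (L : FastDiffusion.L2 m →ₗ.[ℝ] FastDiffusion.L2 m) (hL : IsSelfAdjoint L)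
    {ι : Type*} (S : FastDiffusion.EigenSystem L ι)
    (q : ι → ℝ) (hq : Summable fun i => q i ^ 2 / S.ev i)
    (r : ℝ) (hr0 : 0 < r) (hr1 : r < 1)
    (ε : ℝ) (hε0 : 0 < ε) (hε1 : ε < 1)
    (d : ℝ) (hd0 : 0 < d) (hd : d < 2 * ε * (1 + r) / (1 - r))
    (hN : FastDiffusion.NashInequality L d)
    (n : ℕ) (hn : 1 ≤ n)
    (hDir : FastDiffusion.IsDirichletOperator (-(S.negPow (1 / (n : ℝ)))))
    (c : ℝ) (hc : 0 < c) (σ : ℝ) (hσ : 4 / (1 + r) ≤ σ)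
    (hqc : ∀ i, c * S.ev i ^ ((σ + 2 * ε - 2) / (2 * σ)) ≤ q i) :
    haveI : Fact (1 ≤ ENNReal.ofReal (r + 1)) := FastDiffusion.fact_one_le_ofReal hr0
    (∃! Q : FastDiffusion.L2 m →L[ℝ] S.H, S.IsDiagonal q Q) ∧
    ∃ J : MeasureTheory.Lp ℝ (ENNReal.ofReal (r + 1)) m →L[ℝ] S.H,
      S.IsEmbedding J ∧ IsCompactOperator J ∧
      ∀ Q : FastDiffusion.L2 m →L[ℝ] S.H, S.IsDiagonal q Q →
        S.IsHilbertSchmidt Q ∧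
        ∃ ξ : ℝ, 0 < ξ ∧ ∀ x : MeasureTheory.Lp ℝ (ENNReal.ofReal (r + 1)) m,
          ENNReal.ofReal ξ * S.qNorm Q (J x) ^ σ ≤ ‖x‖ₑ ^ 2 * ‖J x‖ₑ ^ (σ - 2) := by
  have hp1 : Fact (1 ≤ ENNReal.ofReal (r + 1)) := FastDiffusion.fact_one_le_ofReal hr0
  have hp2 := FastDiffusion.ofReal_add_one_le_two hr1
  -- The bound `σ ≥ 4/(1+r)` enters only through `σ > 2`.
  have hσ2 : 2 < σ := lt_of_lt_of_le (by rw [lt_div_iff₀ (by linarith)]; linarith) hσ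
  refine ⟨⟨_, (S.isDiagonal_iff hq _).2 rfl, fun Q hQ => (S.isDiagonal_iff hq Q).1 hQ⟩, ?_⟩
  obtain ⟨K, hK, hsob⟩ := S.exists_sobolev hL hd0 hN hn hDir hr0 hr1 hε0 hd
  have hdense := FastDiffusion.denseRange_inclLp (m := m) ENNReal.ofReal_ne_top hp2
  set V := (S.invPow (half_pos hε0).le).toLinearMap.extendOfNorm (FastDiffusion.inclLp hp2) with hV
  have hVext : ∀ f, V (FastDiffusion.inclLp hp2 f) = S.invPow (half_pos hε0).le f := fun f =>
    LinearMap.extendOfNorm_eq hdense ⟨K, hsob⟩ f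
  have hVnorm : ∀ x, ‖V x‖ ≤ K * ‖x‖ := LinearMap.norm_extendOfNorm_apply_le hdense K hsob
  have hVinj : Function.Injective V :=
    S.injective_of_extends_invPow hn hDir (half_pos hε0).le (by linarith) hp2 V hVext
  have hbd := S.exists_abs_ev_rpow_le (α := (ε - 1) / 2) (by linarith)
  set D := S.basis.diagonal S.basisH (fun i => S.ev i ^ ((ε - 1) / 2)) hbd with hD
  have hDrepr : ∀ y i, S.basisH.repr (D y) i = S.ev i ^ ((ε - 1) / 2) * S.basis.repr y i :=
    fun y i => HilbertBasis.repr_diagonal _ _ _ _ _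
  have hDinj : Function.Injective D := fun y z hyz => S.basis.ext_repr fun i => by
    have h := hDrepr y i
    rw [hyz, hDrepr] at h
    exact (mul_left_cancel₀ (Real.rpow_pos_of_pos (S.ev_pos i) _).ne' h).symm
  have hDcomp : IsCompactOperator D := by
    refine HilbertBasis.isCompactOperator_diagonal _ _ hbd ?_
    have h := (tendsto_rpow_neg_atTop (show 0 < (1 - ε) / 2 by linarith)).comp S.tendsto_ev
    refine h.congr fun i => ?_
    rw [Function.comp_apply, ← neg_div, neg_sub]
  -- The exponents add up to `(ε-1)/2 - ε/2 = -1/2`, the power in the coordinates of `L²(m) ⊂ H`.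
  have hJ : ∀ f, D (V (FastDiffusion.inclLp hp2 f)) = S.toH f := fun f =>
    S.basisH.ext_repr fun i => by
      rw [hDrepr, hVext, S.repr_invPow, S.repr_toH, ← mul_assoc, Real.sqrt_eq_rpow,
        ← Real.rpow_neg (S.ev_pos i).le, ← Real.rpow_add (S.ev_pos i)]
      congr 2
      ring
  refine ⟨D.comp V, ⟨hDinj.comp hVinj, fun f g hfg => ?_⟩, hDcomp.comp_clm V, fun Q hQ =>
    ⟨S.isHilbertSchmidt_of_isDiagonal hq hQ, c ^ σ / K ^ 2, by positivity, fun x => ?_⟩⟩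
  · rw [← hJ f]
    exact congrArg (fun u => D (V u)) (Lp.ext hfg.symm)
  · obtain ⟨z, hz, hzle⟩ := S.exists_preimage_norm_le hq hQ hc hσ2 hqc (hDrepr (V x))
    -- One preimage suffices to bound the infimum; its uniqueness is not needed.
    have h1 : S.qNorm Q (D (V x)) ≤ ‖z‖ₑ := iInf₂_le z hz
    have h2 : c ^ σ / K ^ 2 * ‖z‖ ^ σ ≤ ‖x‖ ^ 2 * ‖D (V x)‖ ^ (σ - 2) := by
      rw [div_mul_eq_mul_div, div_le_iff₀ (by positivity)]
      refine hzle.trans ?_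
      calc ‖V x‖ ^ 2 * ‖D (V x)‖ ^ (σ - 2) ≤ (K * ‖x‖) ^ 2 * ‖D (V x)‖ ^ (σ - 2) := by
            gcongr
            exact hVnorm x
        _ = _ := by ring
    calc ENNReal.ofReal (c ^ σ / K ^ 2) * S.qNorm Q (D (V x)) ^ σ
        ≤ ENNReal.ofReal (c ^ σ / K ^ 2) * ‖z‖ₑ ^ σ := by gcongr
      _ = ENNReal.ofReal (c ^ σ / K ^ 2 * ‖z‖ ^ σ) := by
          rw [ENNReal.ofReal_mul (by positivity), ← ofReal_norm,
            ENNReal.ofReal_rpow_of_nonneg (norm_nonneg _) (by linarith)]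
      _ ≤ ENNReal.ofReal (‖x‖ ^ 2 * ‖D (V x)‖ ^ (σ - 2)) := ENNReal.ofReal_le_ofReal h2
      _ = ‖x‖ₑ ^ 2 * ‖D (V x)‖ₑ ^ (σ - 2) := by
          rw [ENNReal.ofReal_mul (by positivity), ENNReal.ofReal_pow (norm_nonneg _),
            ← ENNReal.ofReal_rpow_of_nonneg (norm_nonneg _) (by linarith), ofReal_norm,
            ofReal_norm]
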